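/- Let $K$ be an algebraically closed field of characteristic zero, let $\mathcal F_d$ be the space of forms of degree $d$ in $x_0,\dots,x_3$ over $K$, and let $\mathcal C\subset\mathcal F_2\times G(3,\mathcal F_2)$ be the tautological rank-$3$ subbundle over the Grassmannian of nets (three-dimensional spaces) of quadratic forms. Let $\mathbb X\subset G(3,\mathcal F_2)$ be the closed subvariety, with its reduced structure, of determinantal nets, i.e. of the nets spanned by the $2\times2$ minors of a $3\times 2$ matrix of linear forms. Let $\mathbb G\subset\mathbb X$ be the closed subvariety, with its reduced structure, of the nets $(L)^2=\langle h^2,hh',h'^2\rangle$, where $L=\{h=h'=0\}$ runs over the lines of $\mathbb P^3$. Let $$\mu: S_2(\mathcal C)|_{\mathbb X}\longrightarrow \mathcal F_4\times\mathbb X$$ be the map of vector bundles induced by multiplication of forms. Then $\mu$ has rank $6$ at every point of $\mathbb X\setminus\mathbb G$, and $\mathbb G$ is exactly (as a closed subscheme of $\mathbb X$) the zero scheme of $\bigwedge^6\mu:\bigwedge^6 S_2(\mathcal C)|_{\mathbb X}\to\bigwedge^6\mathcal F_4\times\mathbb X$. -/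

import Mathlib

noncomputable section

namespace DetNets

/-- `𝓕_d` over a commutative ring `A`: the forms of degree `d` in `x₀, x₁, x₂, x₃` with
coefficients in `A`. -/
abbrev Form (A : Type*) [CommRing A] (d : ℕ) : Type _ :=
  ↥(MvPolynomial.homogeneousSubmodule (Fin 4) A d)

/-- Extension of the coefficients of a form from `K` to a `K`-algebra `A`. -/
def Form.baseChange {K : Type*} [CommRing K] (A : Type*) [CommRing A] [Algebra K A] {d : ℕ}
    (f : Form K d) : Form A d :=
  ⟨MvPolynomial.map (algebraMap K A) f.1, f.2.map (algebraMap K A)⟩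

section Multiplication

variable {A : Type*} [CommRing A]

/-- The second symmetric power `S₂(M)` of an `A`-module, as the degree two piece of the symmetric
algebra of `M`. -/
abbrev SymSq (A : Type*) [CommRing A] (M : Type*) [AddCommGroup M] [Module A M] :
    Submodule A (SymmetricAlgebra A M) :=
  LinearMap.range (SymmetricAlgebra.ι A M) ^ 2

/-- The inclusion of a module `C` of quadratic forms into the polynomial ring. -/
def toPoly (C : Submodule A (Form A 2)) : C →ₗ[A] MvPolynomial (Fin 4) A :=
  (MvPolynomial.homogeneousSubmodule (Fin 4) A 2).subtype ∘ₗ C.subtype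

theorem lift_toPoly_mem (C : Submodule A (Form A 2)) (s : SymmetricAlgebra A C)
    (hs : s ∈ SymSq A C) :
    SymmetricAlgebra.lift (toPoly C) s ∈ MvPolynomial.homogeneousSubmodule (Fin 4) A 4 := by
  have h1 : ∀ q ∈ LinearMap.range (SymmetricAlgebra.ι A C),
      (SymmetricAlgebra.lift (toPoly C) q).IsHomogeneous 2 := by
    rintro _ ⟨c, rfl⟩
    rw [SymmetricAlgebra.lift_ι_apply]
    exact c.1.2
  rw [SymSq, pow_two] at hs
  refine Submodule.mul_induction_on hs (fun p hp q hq => ?_) (fun p q hp hq => ?_)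
  · rw [map_mul]
    exact (h1 p hp).mul (h1 q hq)
  · rw [map_add]
    exact Submodule.add_mem _ hp hq

/-- The multiplication map `μ : S₂(C) → 𝓕₄`, `q · q' ↦ q q'`, of a module `C` of quadratic
forms. -/
def mulMap (C : Submodule A (Form A 2)) : SymSq A C →ₗ[A] Form A 4 :=
  ((SymmetricAlgebra.lift (toPoly C)).toLinearMap ∘ₗ (SymSq A C).subtype).codRestrict
    (MvPolynomial.homogeneousSubmodule (Fin 4) A 4) (fun s => lift_toPoly_mem C s.1 s.2)

/-- The ideal of the zero scheme in `Spec A` of a linear map `φ : M → N`, where `N` is a free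
module: it is generated by the coordinates of all the values of `φ`. -/
def zeroIdeal {M N : Type*} [AddCommGroup M] [Module A M] [AddCommGroup N] [Module A N]
    (φ : M →ₗ[A] N) : Ideal A :=
  Ideal.span {r | ∃ (m : M) (f : N →ₗ[A] A), f (φ m) = r}

end Multiplication

section Varieties

variable (K : Type*) [Field K]

/-- The (points of the) variety `𝕏 ⊂ G(3, 𝓕₂)` of determinantal nets: the three-dimensional spaces
of quadratic forms spanned by the `2 × 2` minors of a `3 × 2` matrix of linear forms. The minor
with index `i` is obtained by deleting the row `i`. -/
def detNets : Set (Submodule K (Form K 2)) :=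
  {W | Module.finrank K W = 3 ∧
    ∃ u : Matrix (Fin 3) (Fin 2) (Form K 1),
      W.map (MvPolynomial.homogeneousSubmodule (Fin 4) K 2).subtype =
        Submodule.span K (Set.range fun i : Fin 3 =>
          ((u.map fun l => (l : MvPolynomial (Fin 4) K)).submatrix i.succAbove id).det)}

/-- The (points of the) variety `𝔾` of the nets `(L)²`, where `L` is a line of `ℙ³`: a line is given
by the two-dimensional space `L` of the linear forms that vanish on it, and the net is the space
spanned by the products of two elements of `L`. -/
def lineSquareNets : Set (Submodule K (Form K 2)) :=
  {W | ∃ L : Submodule K (Form K 1), Module.finrank K L = 2 ∧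
    W.map (MvPolynomial.homogeneousSubmodule (Fin 4) K 2).subtype =
      L.map (MvPolynomial.homogeneousSubmodule (Fin 4) K 1).subtype ^ 2}

end Varieties

section Charts

variable {K : Type*} [Field K]

/-- The standard affine chart `𝔸²¹` of `G(3, 𝓕₂)` attached to a basis `b` of `𝓕₂` whose first three
elements are distinguished: the net with coordinates `a i j` is spanned by
`b i + ∑ j, a i j • b' j`, where `b'` denotes the seven other elements. The coordinates may lie in
any `K`-algebra `A`. The point `a = 0` is the span of the first three elements of `b`, so these
charts cover the Grassmannian when `b` varies. -/
def chartNet (b : Module.Basis (Fin 3 ⊕ Fin 7) K (Form K 2)) {A : Type*} [CommRing A] [Algebra K A]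
    (a : Fin 3 × Fin 7 → A) : Submodule A (Form A 2) :=
  Submodule.span A (Set.range fun i : Fin 3 =>
    (b (Sum.inl i)).baseChange A + ∑ j : Fin 7, a (i, j) • (b (Sum.inr j)).baseChange A)

/-- The ideal, in the chart attached to `b`, of the closed subvariety of `G(3, 𝓕₂)` (with its
reduced structure) with set of points `S`. -/
def chartIdeal (b : Module.Basis (Fin 3 ⊕ Fin 7) K (Form K 2)) (S : Set (Submodule K (Form K 2))) :
    Ideal (MvPolynomial (Fin 3 × Fin 7) K) :=
  MvPolynomial.vanishingIdeal K {a : Fin 3 × Fin 7 → K | chartNet b a ∈ S}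

/-- The coordinate ring of the intersection of `𝕏` with the chart attached to `b`. -/
abbrev CoordRing (b : Module.Basis (Fin 3 ⊕ Fin 7) K (Form K 2)) : Type _ :=
  MvPolynomial (Fin 3 × Fin 7) K ⧸ chartIdeal b (detNets K)

/-- The restriction to `𝕏`, in the chart attached to `b`, of the tautological subbundle
`𝓒 ⊂ 𝓕₂ × G(3, 𝓕₂)`: the net whose coordinates are the coordinate functions. -/
def tautNet (b : Module.Basis (Fin 3 ⊕ Fin 7) K (Form K 2)) :
    Submodule (CoordRing b) (Form (CoordRing b) 2) :=
  chartNet b fun ij => Ideal.Quotient.mk (chartIdeal b (detNets K)) (MvPolynomial.X ij)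

/-- The ideal, in the chart attached to `b`, of the closed subscheme of `𝕏` where
`⋀⁶ μ : ⋀⁶ S₂(𝓒)|_𝕏 → ⋀⁶ 𝓕₄` vanishes. -/
def zeroSchemeIdeal (b : Module.Basis (Fin 3 ⊕ Fin 7) K (Form K 2)) :
    Ideal (MvPolynomial (Fin 3 × Fin 7) K) :=
  (zeroIdeal (exteriorPower.map 6 (mulMap (tautNet b)))).comap
    (Ideal.Quotient.mk (chartIdeal b (detNets K)))

end Charts

end DetNets

end

/-!
A net `W = ⟨q₀, q₁, q₂⟩` on which the six products `q_i q_j` are dependent satisfies a quadratic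
relation. It is diagonalized; since the polynomial ring is a domain and the `q_i` are independent,
its rank is three, so it reads `P Q = v²` with `P`, `Q`, `v` another basis of `W`. Unique
factorization gives `P = h²`, `Q = k²`, `v = ± h k`, hence `W = (h, k)²`
(`exists_line_of_dependent_products`). This is the statement on the rank, and it shows that the zero
scheme of `⋀⁶ μ` and `𝔾` have the same points.

One inclusion of ideals is then evident, because `⋀⁶ μ` vanishes at every point of the reduced
variety `𝔾`, where `q₀ q₂ = q₁²` (`zeroIdeal_le`, `zeroSchemeIdeal_le_chartIdeal`). For the
other one, it must be shown that a function `g` vanishing on `𝔾` belongs to the ideal `J` of the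
zero scheme. If not, the ideal of the `r` with `r g ∈ J` is contained in a maximal ideal, that is,
in the ideal of a point `z` of the zero scheme. By the first paragraph `z` is a net `(h, k)²`, and a
linear substitution moves it to `(x₀, x₁)²`. Near this net, a net over any `K`-algebra `A` has
unique generators `q₀ = x₁² + ⋯`, `q₁ = x₀ x₁ + ⋯`, `q₂ = x₀² + ⋯`, where the dots stand for
elements of `(x₂, x₃)`, and everything can be computed with them (denominators are cleared by means
of an adjugate matrix):

* A determinantal net has two independent linear syzygies. Eliminating them shows that the
  coefficients of `x₂²`, `x₂ x₃`, `x₃²` in the `q_i` are polynomials in the twelve coefficients of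
  the mixed monomials (`IsNormalized.graphEq_eq_zero`). So `𝕏` lies in the graph of a map.
* The products other than `q₀ q₂` restrict to the five quartic monomials in `x₀, x₁`, and
  `q₀ q₂ - q₁²` restricts to zero. Hence a minor on these five monomials and one other monomial is
  just a coefficient of `q₀ q₂ - q₁²`. For the monomials of degree one in `x₂, x₃` this coefficient
  is linear, and these eight linear equations, together with the equations of the graph, say exactly
  that the `q_i` are the products of two linear forms `x₀ + ⋯`, `x₁ + ⋯`, over any ring `A`
  (`IsNormalized.eq_lineQuadrics`).
* These products form a family over the affine space `𝔸⁴`. A polynomial on it is determined by its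
  values since `K` is infinite, so a function that vanishes on `𝔾` vanishes on the members of the
  family over any `A` (`aeval_eq_zero_of_mem_chartIdeal`).

Applied to a localization `A` of the coordinate ring of the zero scheme at a function `δ` with
`δ(z) ≠ 0`, this gives `δⁿ g ∈ J`, which contradicts the choice of `z`
(`chartIdeal_le_zeroSchemeIdeal_of_lines`).
-/
noncomputable section

namespace DetNets

open MvPolynomial

/-! ### Generators of a net, the multiplication map, coefficients of quadratic forms -/

/-- The six index pairs `i ≤ j` in `Fin 3`. The pair `(0, 2)` comes last, because the products of
a net of the form `(L)²` satisfy the relation `q₀ q₂ = q₁²`. -/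
def pair : Fin 6 → Fin 3 × Fin 3 := ![(0, 0), (0, 1), (1, 1), (1, 2), (2, 2), (0, 2)]

/-- The six products of two elements of the triple `c`. -/
def products {B : Type*} [Mul B] (c : Fin 3 → B) (t : Fin 6) : B := c (pair t).1 * c (pair t).2

theorem exists_products_eq {B : Type*} [CommRing B] (c : Fin 3 → B) (i j : Fin 3) :
    ∃ t, products c t = c i * c j := by
  have h : ∀ i j : Fin 3, ∃ t, pair t = (i, j) ∨ pair t = (j, i) := by decide
  obtain ⟨t, ht | ht⟩ := h i j
  · exact ⟨t, by simp [products, ht]⟩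
  · exact ⟨t, by simp [products, ht, mul_comm]⟩

theorem span_mul_span_self {A B : Type*} [CommRing A] [CommRing B] [Algebra A B] (c : Fin 3 → B) :
    Submodule.span A (Set.range c) * Submodule.span A (Set.range c) =
      Submodule.span A (Set.range (products c)) := by
  rw [Submodule.span_mul_span]
  apply le_antisymm <;> refine Submodule.span_mono ?_
  · rintro _ ⟨_, ⟨i, rfl⟩, _, ⟨j, rfl⟩, rfl⟩
    exact exists_products_eq c i j
  · rintro _ ⟨t, rfl⟩
    exact Set.mul_mem_mul ⟨_, rfl⟩ ⟨_, rfl⟩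

section Generators

variable {K : Type*} [Field K]
variable {A A' : Type*} [CommRing A] [Algebra K A] [CommRing A'] [Algebra K A']

/-- The `i`-th of the three polynomials that generate the net with coordinates `a` in the chart
attached to `b`. -/
def gen (b : Module.Basis (Fin 3 ⊕ Fin 7) K (Form K 2)) (a : Fin 3 × Fin 7 → A) (i : Fin 3) :
    MvPolynomial (Fin 4) A :=
  map (algebraMap K A) (b (Sum.inl i)).1 +
    ∑ j : Fin 7, a (i, j) • map (algebraMap K A) (b (Sum.inr j)).1

variable (b : Module.Basis (Fin 3 ⊕ Fin 7) K (Form K 2))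

theorem coe_chartNet_generator (a : Fin 3 × Fin 7 → A) (i : Fin 3) :
    (((b (Sum.inl i)).baseChange A + ∑ j : Fin 7, a (i, j) • (b (Sum.inr j)).baseChange A :
      Form A 2) : MvPolynomial (Fin 4) A) = gen b a i := by
  simp [gen, Form.baseChange]

theorem map_chartNet (a : Fin 3 × Fin 7 → A) :
    (chartNet b a).map (homogeneousSubmodule (Fin 4) A 2).subtype =
      Submodule.span A (Set.range (gen b a)) := by
  rw [chartNet, Submodule.map_span, ← Set.range_comp]
  exact congrArg (fun f => Submodule.span A (Set.range f)) (funext (coe_chartNet_generator b a))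

theorem gen_isHomogeneous (a : Fin 3 × Fin 7 → A) (i : Fin 3) : (gen b a i).IsHomogeneous 2 := by
  rw [← coe_chartNet_generator b a i]
  exact (mem_homogeneousSubmodule 2 _).1 (Subtype.property _)

theorem map_gen (φ : A →ₐ[K] A') (a : Fin 3 × Fin 7 → A) (i : Fin 3) :
    map (φ : A →+* A') (gen b a i) = gen b (fun ij => φ (a ij)) i := by
  simp [gen, map_sum, smul_eq_C_mul, MvPolynomial.map_map]

end Generators

section SymSq

variable {A : Type*} [CommRing A] (C : Submodule A (Form A 2))

theorem mulMap_mem (s : SymSq A C) :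
    (mulMap C s : MvPolynomial (Fin 4) A) ∈
      C.map (homogeneousSubmodule (Fin 4) A 2).subtype *
        C.map (homogeneousSubmodule (Fin 4) A 2).subtype := by
  obtain ⟨s, hs⟩ := s
  change SymmetricAlgebra.lift (toPoly C) s ∈ _
  rw [SymSq, pow_two] at hs
  refine Submodule.mul_induction_on hs ?_ fun p q hp hq => ?_
  · rintro _ ⟨c, rfl⟩ _ ⟨c', rfl⟩
    rw [map_mul, SymmetricAlgebra.lift_ι_apply, SymmetricAlgebra.lift_ι_apply]
    exact Submodule.mul_mem_mul ⟨c.1, c.2, rfl⟩ ⟨c'.1, c'.2, rfl⟩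
  · rw [map_add]
    exact add_mem hp hq

/-- The element `q · q'` of `S₂(C)`. -/
def symMul (q q' : C) : SymSq A C :=
  ⟨SymmetricAlgebra.ι A C q * SymmetricAlgebra.ι A C q', by
    rw [SymSq, pow_two]; exact Submodule.mul_mem_mul ⟨q, rfl⟩ ⟨q', rfl⟩⟩

theorem coe_mulMap_symMul (q q' : C) :
    (mulMap C (symMul C q q') : MvPolynomial (Fin 4) A) = q.1.1 * q'.1.1 := by
  change SymmetricAlgebra.lift (toPoly C) (symMul C q q').1 = _
  simp only [symMul, map_mul, SymmetricAlgebra.lift_ι_apply]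
  rfl

end SymSq

section Coefficients

variable {A A' : Type*} [CommRing A] [CommRing A']

/-- The coefficient of `x_i x_j` in a quadratic form, obtained from its values by polarization. This
makes `coef i j` symmetric in `i` and `j`. -/
def coef (i j : Fin 4) : MvPolynomial (Fin 4) A →ₗ[A] A :=
  if i = j then (aeval (Pi.single i 1 : Fin 4 → A)).toLinearMap
  else (aeval (Pi.single i 1 + Pi.single j 1 : Fin 4 → A)).toLinearMap -
    (aeval (Pi.single i 1 : Fin 4 → A)).toLinearMap -
    (aeval (Pi.single j 1 : Fin 4 → A)).toLinearMap

theorem coef_map (f : A →+* A') (p : MvPolynomial (Fin 4) A) (i j : Fin 4) :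
    coef i j (map f p) = f (coef i j p) := by
  have key : ∀ (z : Fin 4 → A), aeval (fun k => f (z k)) (map f p) = f (aeval z p) := by
    intro z
    rw [aeval_def, eval₂_map, aeval_def, eval₂_comp_left]
    rfl
  have h1 : ∀ i : Fin 4, (fun k => f ((Pi.single i 1 : Fin 4 → A) k)) = Pi.single i 1 := by
    intro i; funext k; by_cases h : k = i
    · subst h; simp
    · simp [h]
  have h2 : (fun k => f ((Pi.single i 1 + Pi.single j 1 : Fin 4 → A) k)) =
      Pi.single i 1 + Pi.single j 1 := by
    rw [← h1 i, ← h1 j]; funext k; simp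
  unfold coef
  split_ifs
  · simp only [AlgHom.toLinearMap_apply, ← key, h1]
  · simp only [LinearMap.sub_apply, AlgHom.toLinearMap_apply, map_sub, ← key, h1, h2]

theorem exists_linear_expansion {p : MvPolynomial (Fin 4) A} (hp : p.IsHomogeneous 1) :
    ∃ c : Fin 4 → A, p = ∑ i, C (c i) * X i := by
  rw [← mem_homogeneousSubmodule, homogeneousSubmodule_one_eq_span_X,
    Submodule.mem_span_range_iff_exists_fun] at hp
  obtain ⟨c, rfl⟩ := hp
  exact ⟨c, by simp [smul_eq_C_mul]⟩

theorem exists_quadratic_expansion {p : MvPolynomial (Fin 4) A} (hp : p.IsHomogeneous 2) :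
    ∃ c : Fin 4 → Fin 4 → A, p = ∑ i, ∑ j, C (c i j) * (X i * X j) := by
  rw [← mem_homogeneousSubmodule, ← homogeneousSubmodule_one_pow, pow_two] at hp
  refine Submodule.mul_induction_on hp (fun p hp q hq => ?_) ?_
  · obtain ⟨c, rfl⟩ := exists_linear_expansion hp
    obtain ⟨d, rfl⟩ := exists_linear_expansion hq
    refine ⟨fun i j => c i * d j, ?_⟩
    simp only [Finset.sum_mul_sum, C_mul]
    exact Finset.sum_congr rfl fun i _ => Finset.sum_congr rfl fun j _ => by ring
  · rintro _ _ ⟨c, rfl⟩ ⟨d, rfl⟩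
    exact ⟨fun i j => c i j + d i j, by simp only [C_add, add_mul, Finset.sum_add_distrib]⟩

theorem quadratic_expansion {p : MvPolynomial (Fin 4) A} (hp : p.IsHomogeneous 2) :
    p = C (coef 0 0 p) * X 0 ^ 2 + C (coef 0 1 p) * (X 0 * X 1) + C (coef 1 1 p) * X 1 ^ 2 +
      (C (coef 0 2 p) * X 2 + C (coef 0 3 p) * X 3) * X 0 +
      (C (coef 1 2 p) * X 2 + C (coef 1 3 p) * X 3) * X 1 +
      (C (coef 2 2 p) * X 2 ^ 2 + C (coef 2 3 p) * (X 2 * X 3) + C (coef 3 3 p) * X 3 ^ 2) := by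
  obtain ⟨c, rfl⟩ := exists_quadratic_expansion hp
  simp only [coef, Fin.sum_univ_four, Fin.isValue]
  simp
  ring

end Coefficients

/-! ### The minors of the multiplication map, and coordinates in a chart -/

section Chart

section Minors

variable {A : Type*} [CommRing A]

/-- The scheme-theoretic condition that the multiplication map of the module `V` of quadratic forms
has rank less than six: all its `6 × 6` minors vanish. A minor is the determinant of the values of
six linear functions on six elements of `V * V`. -/
def MinorsVanish (V : Submodule A (MvPolynomial (Fin 4) A)) : Prop :=
  ∀ w : Fin 6 → MvPolynomial (Fin 4) A, (∀ j, w j ∈ V * V) →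
    ∀ g : Fin 6 → (MvPolynomial (Fin 4) A →ₗ[A] A), (Matrix.of fun j i => g i (w j)).det = 0

theorem MinorsVanish.map {V : Submodule A (MvPolynomial (Fin 4) A)} (hV : MinorsVanish V)
    (σ : MvPolynomial (Fin 4) A →ₐ[A] MvPolynomial (Fin 4) A) :
    MinorsVanish (V.map σ.toLinearMap) := by
  intro w hw g
  have hw' : ∀ j, ∃ u ∈ V * V, σ u = w j := by
    intro j
    have := hw j
    rwa [← Submodule.map_mul] at this
  choose u hu hσ using hw'
  simpa [hσ] using hV u hu fun i => (g i) ∘ₗ σ.toLinearMap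

theorem det_sum_rows {n β : Type*} [Fintype n] [DecidableEq n] [DecidableEq β] (S : Finset β)
    (f : n → β → n → A) : Matrix.det (fun i => ∑ m ∈ S, f i m) =
      ∑ r ∈ Fintype.piFinset fun _ : n => S, Matrix.det (Matrix.of fun i => f i (r i)) :=
  (Matrix.detRowAlternating (n := n) (R := A)).toMultilinearMap.map_sum_finset f fun _ => S

/-- It suffices to know the minors with respect to the coefficients of the products of generators:
all other minors are linear combinations of these. -/
theorem minorsVanish_span (c : Fin 3 → MvPolynomial (Fin 4) A)
    (h : ∀ e : Fin 6 → (Fin 4 →₀ ℕ), (Matrix.of fun j i => coeff (e i) (products c j)).det = 0) :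
    MinorsVanish (Submodule.span A (Set.range c)) := by
  intro w hw g
  have hv : (Matrix.of fun j i => g i (products c j)).det = 0 := by
    set S : Finset (Fin 4 →₀ ℕ) := Finset.univ.biUnion fun j => (products c j).support with hS
    have hrow : ∀ i j, g i (products c j) =
        ∑ m ∈ S, g i (monomial m 1) * coeff m (products c j) := by
      intro i j
      have hsub : (products c j).support ⊆ S :=
        Finset.subset_biUnion_of_mem (fun j => (products c j).support) (Finset.mem_univ j)
      conv_lhs => rw [(products c j).as_sum, map_sum]
      rw [Finset.sum_subset hsub]
      · refine Finset.sum_congr rfl fun m _ => ?_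
        rw [mul_comm, ← smul_eq_mul, ← map_smul, smul_monomial, smul_eq_mul, mul_one]
      · intro m _ hm
        rw [notMem_support_iff.1 hm]; simp
    rw [← Matrix.det_transpose]
    have hmat : (Matrix.of fun j i => g i (products c j)).transpose = fun i =>
        ∑ m ∈ S, fun j => g i (monomial m 1) * coeff m (products c j) := by
      funext i j
      simp [hrow, Finset.sum_apply]
    have hexp : Matrix.det (fun i => ∑ m ∈ S, fun j =>
          g i (monomial m 1) * coeff m (products c j)) =
        ∑ r ∈ Fintype.piFinset fun _ : Fin 6 => S, Matrix.det (Matrix.of fun i j =>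
          g i (monomial (r i) 1) * coeff (r i) (products c j)) :=
      det_sum_rows S fun i m j => g i (monomial m 1) * coeff m (products c j)
    rw [hmat, hexp]
    refine Finset.sum_eq_zero fun r _ => ?_
    have h0 := h r
    rw [← Matrix.det_transpose] at h0
    exact (Matrix.det_mul_column _
      (Matrix.of fun j i => coeff (r i) (products c j)).transpose).trans (by rw [h0, mul_zero])
  rw [span_mul_span_self] at hw
  choose P hP using fun j => (Submodule.mem_span_range_iff_exists_fun A).1 (hw j)
  have : (Matrix.of fun j i => g i (w j)) =
      Matrix.of P * Matrix.of fun j i => g i (products c j) := by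
    ext j i
    simp [Matrix.mul_apply, ← hP]
  rw [this, Matrix.det_mul, hv, mul_zero]

end Minors

variable {K : Type*} [Field K] (b : Module.Basis (Fin 3 ⊕ Fin 7) K (Form K 2))

/-- The coordinates of the universal net over the chart. -/
abbrev univCoord : Fin 3 × Fin 7 → MvPolynomial (Fin 3 × Fin 7) K := X

theorem det_coeff_mem_zeroIdeal {A : Type*} [CommRing A] (C : Submodule A (Form A 2))
    (q q' : Fin 6 → C) (e : Fin 6 → (Fin 4 →₀ ℕ)) :
    (Matrix.of fun j i => coeff (e i) ((q j).1.1 * (q' j).1.1)).det ∈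
      zeroIdeal (exteriorPower.map 6 (mulMap C)) := by
  refine Ideal.subset_span ⟨exteriorPower.ιMulti A 6 fun j => symMul C (q j) (q' j),
    exteriorPower.alternatingMapLinearEquiv
      ((Matrix.detRowAlternating (n := Fin 6) (R := A)).compLinearMap
        (LinearMap.pi fun i => lcoeff A (e i) ∘ₗ (homogeneousSubmodule (Fin 4) A 4).subtype)), ?_⟩
  rw [exteriorPower.map_apply_ιMulti (R := A), exteriorPower.alternatingMapLinearEquiv_apply_ιMulti]
  rw [AlternatingMap.compLinearMap_apply]
  refine congrArg (Matrix.detRowAlternating (n := Fin 6) (R := A))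
    (funext fun j => funext fun i => ?_)
  change coeff (e i) (mulMap C (symMul C (q j) (q' j)) : MvPolynomial (Fin 4) A) = _
  rw [coe_mulMap_symMul]
  rfl

theorem det_coeff_mem_zeroSchemeIdeal (e : Fin 6 → (Fin 4 →₀ ℕ)) :
    (Matrix.of fun j i => coeff (e i) (products (gen b (univCoord (K := K))) j)).det ∈
      zeroSchemeIdeal b := by
  set I := chartIdeal b (detNets K)
  rw [zeroSchemeIdeal, Ideal.mem_comap]
  have hgen : ∀ i, ((b (Sum.inl i)).baseChange (CoordRing b) + ∑ j : Fin 7,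
      Ideal.Quotient.mk I (X (i, j)) • (b (Sum.inr j)).baseChange (CoordRing b)) ∈ tautNet b :=
    fun i => Submodule.subset_span ⟨i, rfl⟩
  have := det_coeff_mem_zeroIdeal (tautNet b) (fun t => ⟨_, hgen (pair t).1⟩)
    (fun t => ⟨_, hgen (pair t).2⟩) e
  convert this
  rw [RingHom.map_det]
  congr 1
  ext j i
  have hc := fun i => map_gen b (Ideal.Quotient.mkₐ K I) univCoord i
  have hg := coe_chartNet_generator b (fun ij => Ideal.Quotient.mk I (X ij))
  simp only [RingHom.mapMatrix_apply, Matrix.map_apply, Matrix.of_apply]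
  rw [← coeff_map, hg, hg, products, map_mul]
  exact congrArg₂ (fun p q => coeff (e i) (p * q)) (hc _) (hc _)

/-- A homomorphism that kills the ideal of the zero scheme defines a net on which the minors
vanish. -/
theorem minorsVanish_of_kills {A : Type*} [CommRing A] [Algebra K A]
    (φ : MvPolynomial (Fin 3 × Fin 7) K →ₐ[K] A) (hφ : ∀ r ∈ zeroSchemeIdeal b, φ r = 0) :
    MinorsVanish (Submodule.span A (Set.range (gen b fun ij => φ (X ij)))) := by
  refine minorsVanish_span _ fun e => ?_
  rw [← hφ _ (det_coeff_mem_zeroSchemeIdeal b e), AlgHom.map_det]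
  congr 1
  ext j i
  simp only [Matrix.of_apply, AlgHom.mapMatrix_apply, Matrix.map_apply]
  rw [products, ← map_gen b φ, ← map_gen b φ, ← map_mul, coeff_map]
  rfl

theorem chartIdeal_le_zeroSchemeIdeal : chartIdeal b (detNets K) ≤ zeroSchemeIdeal b :=
  Ideal.mk_ker.symm.trans_le (Ideal.ker_le_comap _)

section Coordinates

variable {A A' : Type*} [CommRing A] [Algebra K A] [CommRing A'] [Algebra K A']

/-- The coordinate of the quadratic part of a polynomial with respect to the basis `b`, over an
arbitrary `K`-algebra. -/
def coord (s : Fin 3 ⊕ Fin 7) : MvPolynomial (Fin 4) A →ₗ[A] A :=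
  (basisMonomials (Fin 4) A).constr A fun m => algebraMap K A
    (b.repr ⟨homogeneousComponent 2 (monomial m 1), homogeneousComponent_isHomogeneous _ _⟩ s)

theorem coord_monomial (s : Fin 3 ⊕ Fin 7) (m : Fin 4 →₀ ℕ) (r : A) :
    coord b s (monomial m r) = r * algebraMap K A
      (b.repr ⟨homogeneousComponent 2 (monomial m 1),
        homogeneousComponent_isHomogeneous _ _⟩ s) := by
  have : monomial m r = r • basisMonomials (Fin 4) A m := by simp [smul_monomial]
  rw [this, map_smul, coord, Module.Basis.constr_basis, smul_eq_mul]

theorem coord_map_algebraMap (s : Fin 3 ⊕ Fin 7) (q : Form K 2) :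
    coord b s (map (algebraMap K A) q.1) = algebraMap K A (b.repr q s) := by
  have key : ∀ p : MvPolynomial (Fin 4) K, coord b s (map (algebraMap K A) p) =
      algebraMap K A
        (b.repr ⟨homogeneousComponent 2 p, homogeneousComponent_isHomogeneous _ _⟩ s) := by
    intro p
    induction p using MvPolynomial.induction_on' with
    | monomial m r =>
      rw [map_monomial, coord_monomial, ← map_mul]
      congr 1
      have : (⟨homogeneousComponent 2 (monomial m r), homogeneousComponent_isHomogeneous _ _⟩ :
          Form K 2) = r • ⟨homogeneousComponent 2 (monomial m 1),
            homogeneousComponent_isHomogeneous _ _⟩ := by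
        apply Subtype.ext
        change homogeneousComponent 2 (monomial m r) = r • homogeneousComponent 2 (monomial m 1)
        rw [← map_smul, smul_monomial, smul_eq_mul, mul_one]
      rw [this, map_smul]; simp
    | add p q hp hq =>
      rw [map_add, map_add, hp, hq, ← map_add, ← Finsupp.add_apply, ← map_add]
      congr 3
      exact Subtype.ext (map_add (homogeneousComponent 2) p q).symm
  rw [key]
  congr 3
  exact Subtype.ext (homogeneousComponent_eq_self q.2)

theorem coord_map (φ : A →ₐ[K] A') (s : Fin 3 ⊕ Fin 7) (p : MvPolynomial (Fin 4) A) :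
    coord b s (map (φ : A →+* A') p) = φ (coord b s p) := by
  induction p using MvPolynomial.induction_on' with
  | monomial m r => simp [coord_monomial]
  | add p q hp hq => simp [hp, hq]

theorem coord_inl_gen (a : Fin 3 × Fin 7 → A) (i k : Fin 3) :
    coord b (Sum.inl k) (gen b a i) = if i = k then 1 else 0 := by
  by_cases h : i = k <;> simp [gen, coord_map_algebraMap, h]

theorem coord_inr_gen (a : Fin 3 × Fin 7 → A) (i : Fin 3) (j : Fin 7) :
    coord b (Sum.inr j) (gen b a i) = a (i, j) := by
  simp [gen, coord_map_algebraMap, Finsupp.single_apply, apply_ite]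

/-- A quadratic form over a `K`-algebra is the combination of the elements of `b` with its
coordinates. -/
theorem sum_coord {q : MvPolynomial (Fin 4) A} (hq : q.IsHomogeneous 2) :
    q = ∑ s, coord b s q • map (algebraMap K A) (b s).1 := by
  obtain ⟨c, rfl⟩ := exists_quadratic_expansion hq
  have key : ∀ i j : Fin 4, (X i * X j : MvPolynomial (Fin 4) A) =
      ∑ s, coord b s (X i * X j : MvPolynomial (Fin 4) A) • map (algebraMap K A) (b s).1 := by
    intro i j
    let q : Form K 2 := ⟨X i * X j, (isHomogeneous_X K i).mul (isHomogeneous_X K j)⟩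
    have h1 : (X i * X j : MvPolynomial (Fin 4) A) = map (algebraMap K A) q.1 := by simp [q]
    rw [h1]
    simp_rw [coord_map_algebraMap]
    calc map (algebraMap K A) q.1 = map (algebraMap K A) (∑ s, b.repr q s • b s : Form K 2).1 := by
          rw [b.sum_repr]
      _ = _ := by
          simp only [Submodule.coe_sum, Submodule.coe_smul, map_sum, smul_eq_C_mul, map_mul, map_C]
  -- Both sides are additive and homogeneous, so the products `X i * X j` suffice.
  let T : MvPolynomial (Fin 4) A →ₗ[A] MvPolynomial (Fin 4) A :=
    ∑ s, (coord b s).smulRight (map (algebraMap K A) (b s).1)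
  have hT : ∀ q, T q = ∑ s, coord b s q • map (algebraMap K A) (b s).1 := by
    intro q; simp only [T, LinearMap.sum_apply, LinearMap.smulRight_apply]
  rw [← hT]
  simp only [map_sum, ← smul_eq_C_mul, map_smul]
  simp only [hT, ← key]

theorem gen_linearIndependent (a : Fin 3 × Fin 7 → A) : LinearIndependent A (gen b a) := by
  rw [Fintype.linearIndependent_iff]
  intro g hg k
  have := congrArg (coord b (Sum.inl k)) hg
  simpa [coord_inl_gen] using this

end Coordinates

end Chart

/-! ### Quadratic relations between quadratic forms -/

section Conics

variable {K : Type*} [Field K]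

theorem linearIndependent_of_mem_span {V : Type*} [AddCommGroup V] [Module K V] {n : ℕ}
    {w w' : Fin n → V} (hw : LinearIndependent K w)
    (h : ∀ i, w i ∈ Submodule.span K (Set.range w')) : LinearIndependent K w' := by
  rw [linearIndependent_iff_card_le_finrank_span]
  have := Module.Finite.span_of_finite K (Set.finite_range w')
  have h1 : Submodule.span K (Set.range w) ≤ Submodule.span K (Set.range w') :=
    Submodule.span_le.2 (by rintro _ ⟨i, rfl⟩; exact h i)
  have h2 := Submodule.finrank_mono h1
  rw [finrank_span_eq_card hw] at h2
  exact h2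

/-- A quadratic relation between three elements can be diagonalized. -/
theorem exists_diagonal_relation [CharZero K] {B : Type*} [CommRing B] [Algebra K B]
    {w : Fin 3 → B} (hw : LinearIndependent K w) (hd : ¬ LinearIndependent K (products w)) :
    ∃ (w' : Fin 3 → B) (d : Fin 3 → K), LinearIndependent K w' ∧
      Submodule.span K (Set.range w') = Submodule.span K (Set.range w) ∧ d ≠ 0 ∧
      ∑ k, d k • (w' k * w' k) = 0 := by
  obtain ⟨ρ, hρ, hne⟩ := Fintype.not_linearIndependent_iff.1 hd
  -- The Gram matrix of twice the relation.
  let S : Matrix (Fin 3) (Fin 3) K :=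
    !![2 * ρ 0, ρ 1, ρ 5; ρ 1, 2 * ρ 2, ρ 3; ρ 5, ρ 3, 2 * ρ 4]
  have hrel : ∑ i, ∑ j, S i j • (w i * w j) = 0 := by
    have h2 : ∑ i, ∑ j, S i j • (w i * w j) = (2 : K) • ∑ t, ρ t • products w t := by
      simp [S, Fin.sum_univ_three, Fin.sum_univ_six, products, pair, Algebra.smul_def,
        map_ofNat (algebraMap K B)]
      ring
    rw [h2, hρ, smul_zero]
  have hS0 : S ≠ 0 := by
    intro h
    obtain ⟨t, ht⟩ := hne
    have e : ∀ i j, S i j = 0 := fun i j => by rw [h]; rfl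
    have e00 := e 0 0; have e01 := e 0 1; have e11 := e 1 1
    have e12 := e 1 2; have e22 := e 2 2; have e02 := e 0 2
    simp [S] at e00 e01 e11 e12 e22 e02
    fin_cases t <;> simp_all
  have hSs : S.IsSymm := by
    ext i j; fin_cases i <;> fin_cases j <;> rfl
  have : Invertible (2 : K) := invertibleOfNonzero two_ne_zero
  obtain ⟨v₀, hv₀⟩ := LinearMap.BilinForm.exists_orthogonal_basis (B := Matrix.toBilin' S)
    (by
      constructor
      intro x y
      simp only [RingHom.id_apply, Matrix.toBilin'_apply]
      rw [Finset.sum_comm]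
      refine Finset.sum_congr rfl fun i _ => Finset.sum_congr rfl fun j _ => ?_
      rw [hSs.apply]; ring)
  have hfr : Module.finrank K (Fin 3 → K) = 3 := by simp
  let v : Module.Basis (Fin 3) K (Fin 3 → K) := v₀.reindex (finCongr hfr)
  have hv : ∀ k l, k ≠ l → ∑ i, ∑ j, v k i * S i j * v l j = 0 := by
    intro k l hkl
    have := hv₀ (i := (finCongr hfr).symm k) (j := (finCongr hfr).symm l) (by simpa using hkl)
    simpa [Matrix.toBilin'_apply, v, Function.onFun] using this
  let w' : Fin 3 → B := fun k => ∑ i, v.repr (Pi.single i 1) k • w i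
  have hww : ∀ i, w i = ∑ k, v k i • w' k := by
    intro i
    have h1 : ∀ j, ∑ k, v.repr (Pi.single j 1) k * v k i = if i = j then 1 else 0 := by
      intro j
      have := congrFun (v.sum_repr (Pi.single j 1)) i
      simpa [Finset.sum_apply, Pi.single_apply] using this
    simp only [w', Finset.smul_sum, smul_smul]
    rw [Finset.sum_comm]
    simp only [← Finset.sum_smul]
    simp [mul_comm (v _ i), h1, ite_smul]
  have hmem : ∀ i, w i ∈ Submodule.span K (Set.range w') := fun i => by
    rw [hww i]
    exact Submodule.sum_mem _ fun k _ => Submodule.smul_mem _ _ (Submodule.subset_span ⟨k, rfl⟩)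
  refine ⟨w', fun k => ∑ i, ∑ j, v k i * S i j * v k j, linearIndependent_of_mem_span hw hmem,
    le_antisymm (Submodule.span_le.2 ?_) (Submodule.span_le.2 ?_), ?_, ?_⟩
  · rintro _ ⟨k, rfl⟩
    exact Submodule.sum_mem _ fun i _ => Submodule.smul_mem _ _ (Submodule.subset_span ⟨i, rfl⟩)
  · rintro _ ⟨i, rfl⟩
    exact hmem i
  · intro h0
    apply hS0
    have hB : Matrix.toBilin' S = 0 := by
      refine LinearMap.BilinForm.ext_basis v fun k l => ?_
      rw [Matrix.toBilin'_apply]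
      by_cases hkl : k = l
      · subst hkl; exact congrFun h0 k
      · exact hv k l hkl
    exact Matrix.toBilin'.injective (by rw [hB, map_zero])
  · rw [← hrel]
    have : ∀ i j, S i j • (w i * w j) =
        ∑ k, ∑ l, (v k i * S i j * v l j) • (w' k * w' l) := by
      intro i j
      rw [hww i, hww j, Finset.sum_mul_sum, Finset.smul_sum]
      refine Finset.sum_congr rfl fun k _ => ?_
      rw [Finset.smul_sum]
      refine Finset.sum_congr rfl fun l _ => ?_
      rw [smul_mul_smul_comm, smul_smul]
      congr 1; ring
    simp only [this]
    have hswap : ∑ i, ∑ j, ∑ k, ∑ l, (v k i * S i j * v l j) • (w' k * w' l) =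
        ∑ k, ∑ l, (∑ i, ∑ j, v k i * S i j * v l j) • (w' k * w' l) := by
      simp only [Finset.sum_smul]
      refine (Finset.sum_congr rfl fun i _ => Finset.sum_comm).trans (Finset.sum_comm.trans ?_)
      exact Finset.sum_congr rfl fun k _ =>
        (Finset.sum_congr rfl fun i _ => Finset.sum_comm).trans Finset.sum_comm
    rw [hswap]
    refine Finset.sum_congr rfl fun k _ => ?_
    rw [Fintype.sum_eq_single (f := fun l => (∑ i, ∑ j, v k i * S i j * v l j) • (w' k * w' l)) k
      fun l hl => by rw [hv k l hl.symm, zero_smul]]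

variable {σ : Type*}

theorem isHomogeneous_one_of_mul_self {p : MvPolynomial σ K} (h2 : (p * p).IsHomogeneous 2) :
    p.IsHomogeneous 1 := by
  by_cases hp : p = 0
  · rw [hp]; exact isHomogeneous_zero _ _ _
  have hd := h2.totalDegree (mul_ne_zero hp hp)
  rw [totalDegree_mul_of_isDomain hp hp] at hd
  have h0 : coeff 0 p = 0 := by
    have := h2.coeff_eq_zero (d := 0) (by simp)
    rw [← constantCoeff_eq, map_mul] at this
    exact mul_self_eq_zero.1 this
  intro d hdp
  have hle : d.degree ≤ 1 := by
    have := le_totalDegree (mem_support_iff.2 hdp)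
    have h' : (d.sum fun _ e => e) = d.degree := rfl
    omega
  have hne : d.degree ≠ 0 := by
    intro h
    rw [Finsupp.degree_eq_zero_iff] at h
    exact hdp (h ▸ h0)
  have : d.degree = 1 := by omega
  rw [Finsupp.degree_eq_weight_one] at this
  exact this

/-- If the product of two quadratic forms that are not proportional is a square, both are
squares of linear forms. -/
theorem exists_squares_of_mul_eq_mul_self [IsAlgClosed K] {P Q v : MvPolynomial σ K}
    (hP : P.IsHomogeneous 2) (hQ : Q.IsHomogeneous 2) (hP0 : P ≠ 0) (hQ0 : Q ≠ 0)
    (hne : ∀ c : K, Q ≠ c • P) (h : P * Q = v * v) :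
    ∃ h k : MvPolynomial σ K, h.IsHomogeneous 1 ∧ k.IsHomogeneous 1 ∧ P = h * h ∧ Q = k * k := by
  -- After division by the greatest common divisor `g`, the coprime cofactors are squares. Then `g`
  -- is a constant, for otherwise the cofactors are constants and `P`, `Q` are proportional.
  let _ := UniqueFactorizationMonoid.toGCDMonoid (MvPolynomial σ K)
  have hunit : ∀ u : MvPolynomial σ K, IsUnit u → ∃ r : K, u = C r * C r := by
    intro u hu
    obtain ⟨r, -, rfl⟩ := isUnit_iff_eq_C_of_isReduced.1 hu
    obtain ⟨s, rfl⟩ := IsAlgClosed.exists_eq_mul_self r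
    exact ⟨s, by simp⟩
  obtain ⟨p, q, hp, hq, hpq⟩ := extract_gcd P Q
  set g := gcd P Q
  have hg0 : g ≠ 0 := by rintro h0; rw [h0, zero_mul] at hp; exact hP0 hp
  have hgv : g ∣ v := by
    refine (IsIntegrallyClosed.pow_dvd_pow_iff two_ne_zero).1 ⟨p * q, ?_⟩
    rw [sq v, ← h]; nth_rw 1 [hp]; nth_rw 1 [hq]; ring
  obtain ⟨y, rfl⟩ := hgv
  have hpqy : p * q = y ^ 2 := by
    have : g * g * (p * q) = g * g * y ^ 2 := by
      calc g * g * (p * q) = (g * p) * (g * q) := by ring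
        _ = P * Q := by rw [← hp, ← hq]
        _ = _ := by rw [h]; ring
    exact mul_left_cancel₀ (mul_ne_zero hg0 hg0) this
  have hsq : ∀ a b : MvPolynomial σ K, IsUnit (gcd a b) → a * b = y ^ 2 → ∃ d, a = d * d := by
    intro a b hab hy
    obtain ⟨d, u, hu⟩ := exists_associated_pow_of_mul_eq_pow hab hy
    obtain ⟨r, hr⟩ := hunit u u.isUnit
    exact ⟨d * C r, by rw [← hu, hr]; ring⟩
  obtain ⟨h', rfl⟩ := hsq p q hpq hpqy
  obtain ⟨k', rfl⟩ := hsq q (h' * h') ((gcd_comm' _ _).isUnit_iff.1 hpq) (by rw [mul_comm, hpqy])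
  have hh0 : h' ≠ 0 := by rintro rfl; simp at hp; exact hP0 hp
  have hk0 : k' ≠ 0 := by rintro rfl; simp at hq; exact hQ0 hq
  have d1 := hP.totalDegree hP0
  have d2 := hQ.totalDegree hQ0
  rw [hp, totalDegree_mul_of_isDomain hg0 (mul_ne_zero hh0 hh0),
    totalDegree_mul_of_isDomain hh0 hh0] at d1
  rw [hq, totalDegree_mul_of_isDomain hg0 (mul_ne_zero hk0 hk0),
    totalDegree_mul_of_isDomain hk0 hk0] at d2
  have hg : g.totalDegree = 0 := by
    by_contra hg
    have e1 : h'.totalDegree = 0 := by omega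
    have e2 : k'.totalDegree = 0 := by omega
    obtain ⟨x, rfl⟩ : ∃ x, h' = C x := ⟨_, totalDegree_eq_zero_iff_eq_C.1 e1⟩
    obtain ⟨y, rfl⟩ : ∃ y, k' = C y := ⟨_, totalDegree_eq_zero_iff_eq_C.1 e2⟩
    have hx : x ≠ 0 := by rintro rfl; exact hh0 C_0
    refine hne (y ^ 2 / x ^ 2) ?_
    have hC : C (y ^ 2 / x ^ 2) * (C x * C x) = (C y * C y : MvPolynomial σ K) := by
      rw [← C_mul, ← C_mul, ← C_mul]
      congr 1
      field_simp
    rw [hp, hq, smul_eq_C_mul]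
    linear_combination -g * hC
  have hgu : IsUnit g := by
    rw [totalDegree_eq_zero_iff_eq_C] at hg
    rw [hg] at hg0 ⊢
    exact (isUnit_iff_ne_zero.2 (fun h0 => hg0 (by rw [h0, C_0]))).map C
  obtain ⟨r, hr⟩ := hunit g hgu
  have eP : P = (C r * h') * (C r * h') := by rw [hp, hr]; ring
  have eQ : Q = (C r * k') * (C r * k') := by rw [hq, hr]; ring
  exact ⟨C r * h', C r * k', isHomogeneous_one_of_mul_self (eP ▸ hP),
    isHomogeneous_one_of_mul_self (eQ ▸ hQ), eP, eQ⟩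

end Conics

/-! ### Nets attached to lines -/

section Lines

/-- The generators `k²`, `h k`, `h²` of the net attached to the line `h = k = 0`. -/
def lineQuadrics {B : Type*} [Mul B] (h k : B) : Fin 3 → B := ![k * k, h * k, h * h]

variable {K : Type*} [Field K]

/-- A diagonal relation between three independent quadratic forms has rank three, and it can be
written as `(w₀ + s w₁) (w₀ - s w₁) = (t w₂)²`; so the two factors are squares. -/
theorem exists_line_of_diagonal_relation [IsAlgClosed K] [CharZero K]
    {w : Fin 3 → MvPolynomial (Fin 4) K} (hom : ∀ i, (w i).IsHomogeneous 2)
    (hw : LinearIndependent K w) {d : Fin 3 → K} (hd : d 0 ≠ 0)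
    (hrel : ∑ i, d i • (w i * w i) = 0) :
    ∃ h k : MvPolynomial (Fin 4) K, h.IsHomogeneous 1 ∧ k.IsHomogeneous 1 ∧
      LinearIndependent K ![h, k] ∧
      Submodule.span K (Set.range w) = Submodule.span K (Set.range (lineQuadrics h k)) := by
  have hind := Fintype.linearIndependent_iff.1 hw
  -- In the independent family `w`, a vanishing combination has vanishing coefficients.
  have hlin : ∀ x y z : K, C x * w 0 + C y * w 1 + C z * w 2 = 0 → x = 0 ∧ y = 0 ∧ z = 0 := by
    intro x y z h
    have := hind ![x, y, z] (by simpa [Fin.sum_univ_three, smul_eq_C_mul] using h)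
    exact ⟨this 0, this 1, this 2⟩
  -- The relation becomes `w₀² - s² w₁² = t² w₂²`, with nonzero `s` and `t` because a difference of
  -- two squares of nonproportional elements cannot vanish in a domain.
  obtain ⟨s, hs⟩ := IsAlgClosed.exists_eq_mul_self (-(d 1 / d 0))
  obtain ⟨t, ht⟩ := IsAlgClosed.exists_eq_mul_self (-(d 2 / d 0))
  have e1 : d 1 = -(d 0 * (s * s)) := by rw [← hs]; field_simp
  have e2 : d 2 = -(d 0 * (t * t)) := by rw [← ht]; field_simp
  have hrel' : w 0 * w 0 - C s * C s * (w 1 * w 1) - C t * C t * (w 2 * w 2) = 0 := by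
    simp only [Fin.sum_univ_three, e1, e2, smul_eq_C_mul, map_neg, map_mul] at hrel
    have h0 : (C (d 0) : MvPolynomial (Fin 4) K) ≠ 0 := by simpa using hd
    refine (mul_eq_zero.1 ?_).resolve_left h0
    linear_combination hrel
  have hs0 : s ≠ 0 := by
    rintro rfl
    have : (w 0 - C t * w 2) * (w 0 + C t * w 2) = 0 := by
      rw [C_0] at hrel'; linear_combination hrel'
    rcases mul_eq_zero.1 this with h | h
    · exact one_ne_zero (hlin 1 0 (-t) (by rw [C_1, C_0, C_neg]; linear_combination h)).1
    · exact one_ne_zero (hlin 1 0 t (by rw [C_1, C_0]; linear_combination h)).1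
  have ht0 : t ≠ 0 := by
    rintro rfl
    have : (w 0 - C s * w 1) * (w 0 + C s * w 1) = 0 := by
      rw [C_0] at hrel'; linear_combination hrel'
    rcases mul_eq_zero.1 this with h | h
    · exact one_ne_zero (hlin 1 (-s) 0 (by rw [C_1, C_0, C_neg]; linear_combination h)).1
    · exact one_ne_zero (hlin 1 s 0 (by rw [C_1, C_0]; linear_combination h)).1
  have hPQ : ∀ x y : K, C x * (w 0 + C s * w 1) + C y * (w 0 - C s * w 1) = 0 → x = 0 ∧ y = 0 := by
    intro x y h
    obtain ⟨h1, h2, -⟩ := hlin (x + y) (s * (x - y)) 0 (by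
      simp only [map_add, map_mul, map_sub, C_0]; linear_combination h)
    have h3 := (mul_eq_zero.1 h2).resolve_left hs0
    have h4 : (2 : K) * x = 0 := by linear_combination h1 + h3
    have h5 := (mul_eq_zero.1 h4).resolve_left two_ne_zero
    exact ⟨h5, by linear_combination h1 - h5⟩
  have hCh : ∀ (c : K) {p : MvPolynomial (Fin 4) K} {n : ℕ}, p.IsHomogeneous n →
      (C c * p).IsHomogeneous n := fun c p n hp => by simpa using (isHomogeneous_C _ c).mul hp
  obtain ⟨h, k, hh, hk, eP, eQ⟩ := exists_squares_of_mul_eq_mul_self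
    (P := w 0 + C s * w 1) (Q := w 0 - C s * w 1) (v := C t * w 2)
    ((hom 0).add (hCh s (hom 1))) ((hom 0).sub (hCh s (hom 1)))
    (fun h0 => one_ne_zero (hPQ 1 0 (by rw [C_1, C_0]; linear_combination h0)).1)
    (fun h0 => one_ne_zero (hPQ 0 1 (by rw [C_1, C_0]; linear_combination h0)).2)
    (fun c hc => one_ne_zero (hPQ (-c) 1 (by
      rw [smul_eq_C_mul] at hc; rw [C_1, C_neg]; linear_combination hc)).2)
    (by linear_combination hrel')
  -- Up to the sign of `h`, the third generator is the product of `h` and `k`.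
  obtain ⟨h, hh, eP, ehk⟩ : ∃ h : MvPolynomial (Fin 4) K, h.IsHomogeneous 1 ∧
      w 0 + C s * w 1 = h * h ∧ C t * w 2 = h * k := by
    have : (C t * w 2 - h * k) * (C t * w 2 + h * k) = 0 := by
      linear_combination hrel' * (-1) - (w 0 - C s * w 1) * (- eP) * (-1) * (-1) + h * h * eQ
    rcases mul_eq_zero.1 this with h0 | h0
    · exact ⟨h, hh, eP, by linear_combination h0⟩
    · exact ⟨-h, hh.neg, by rw [eP]; ring, by linear_combination h0⟩
  refine ⟨h, k, hh, hk, ?_, le_antisymm (Submodule.span_le.2 ?_) (Submodule.span_le.2 ?_)⟩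
  · rw [LinearIndependent.pair_iff]
    intro x y hxy
    obtain ⟨h1, h2⟩ := hPQ (x * x) (-(y * y)) (by
      rw [smul_eq_C_mul, smul_eq_C_mul] at hxy
      rw [eP, eQ, C_neg, C_mul, C_mul]
      linear_combination (C x * h - C y * k) * hxy)
    exact ⟨mul_self_eq_zero.1 h1, mul_self_eq_zero.1 (neg_eq_zero.1 h2)⟩
  · have m0 : k * k ∈ Submodule.span K (Set.range (lineQuadrics h k)) :=
      Submodule.subset_span ⟨0, rfl⟩
    have m1 : h * k ∈ Submodule.span K (Set.range (lineQuadrics h k)) :=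
      Submodule.subset_span ⟨1, rfl⟩
    have m2 : h * h ∈ Submodule.span K (Set.range (lineQuadrics h k)) :=
      Submodule.subset_span ⟨2, rfl⟩
    have c2 : (C (2⁻¹ : K) * 2 : MvPolynomial (Fin 4) K) = 1 := by
      rw [← map_ofNat C 2, ← C_mul]; simp
    have cs : (C s⁻¹ * C s : MvPolynomial (Fin 4) K) = 1 := by rw [← C_mul]; simp [hs0]
    have ct : (C t⁻¹ * C t : MvPolynomial (Fin 4) K) = 1 := by rw [← C_mul]; simp [ht0]
    rintro _ ⟨i, rfl⟩
    fin_cases i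
    · have : w 0 = (2⁻¹ : K) • (h * h) + (2⁻¹ : K) • (k * k) := by
        rw [smul_eq_C_mul, smul_eq_C_mul, ← eP, ← eQ]; linear_combination -w 0 * c2
      rw [SetLike.mem_coe, Fin.zero_eta, this]
      exact add_mem (Submodule.smul_mem _ _ m2) (Submodule.smul_mem _ _ m0)
    · have : w 1 = (2⁻¹ * s⁻¹ : K) • (h * h) - (2⁻¹ * s⁻¹ : K) • (k * k) := by
        rw [smul_eq_C_mul, smul_eq_C_mul, ← eP, ← eQ, C_mul]
        linear_combination -w 1 * c2 - w 1 * C 2⁻¹ * 2 * cs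
      rw [SetLike.mem_coe, Fin.mk_one, this]
      exact sub_mem (Submodule.smul_mem _ _ m2) (Submodule.smul_mem _ _ m0)
    · have : w 2 = (t⁻¹ : K) • (h * k) := by
        rw [smul_eq_C_mul, ← ehk]; linear_combination -w 2 * ct
      have m1' := Submodule.smul_mem _ (t⁻¹ : K) m1
      rw [← this] at m1'
      exact m1'
  · have m : ∀ i, w i ∈ Submodule.span K (Set.range w) := fun i => Submodule.subset_span ⟨i, rfl⟩
    rintro _ ⟨i, rfl⟩
    fin_cases i
    · change k * k ∈ _
      rw [← eQ, ← smul_eq_C_mul]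
      exact sub_mem (m 0) (Submodule.smul_mem _ _ (m 1))
    · change h * k ∈ _
      rw [← ehk, ← smul_eq_C_mul]
      exact Submodule.smul_mem _ _ (m 2)
    · change h * h ∈ _
      rw [← eP, ← smul_eq_C_mul]
      exact add_mem (m 0) (Submodule.smul_mem _ _ (m 1))

/-- Three independent quadratic forms whose products are dependent span a net `(L)²`: the relation
defines a conic, which must be smooth since the polynomial ring is a domain, so that the relation
takes the form `P Q = v²`. -/
theorem exists_line_of_dependent_products [IsAlgClosed K] [CharZero K]
    {w : Fin 3 → MvPolynomial (Fin 4) K} (hom : ∀ i, (w i).IsHomogeneous 2)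
    (hw : LinearIndependent K w) (hd : ¬ LinearIndependent K (products w)) :
    ∃ h k : MvPolynomial (Fin 4) K, h.IsHomogeneous 1 ∧ k.IsHomogeneous 1 ∧
      LinearIndependent K ![h, k] ∧
      Submodule.span K (Set.range w) = Submodule.span K (Set.range (lineQuadrics h k)) := by
  obtain ⟨w', d, hw', hspan, hd0, hrel⟩ := exists_diagonal_relation hw hd
  obtain ⟨i, hi⟩ := Function.ne_iff.1 hd0
  have hom' : ∀ i, (w' i).IsHomogeneous 2 := by
    have : Submodule.span K (Set.range w) ≤ homogeneousSubmodule (Fin 4) K 2 :=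
      Submodule.span_le.2 (by rintro _ ⟨i, rfl⟩; exact hom i)
    exact fun i => this (hspan ▸ Submodule.subset_span ⟨i, rfl⟩)
  let e := Equiv.swap 0 i
  obtain ⟨h, k, hh, hk, hli, hs⟩ := exists_line_of_diagonal_relation (w := w' ∘ e) (d := d ∘ e)
    (fun j => hom' _) (hw'.comp e e.injective) (by simpa [e] using hi)
    ((Equiv.sum_comp e fun j => d j • (w' j * w' j)).trans hrel)
  refine ⟨h, k, hh, hk, hli, ?_⟩
  rw [← hs, ← hspan, e.surjective.range_comp]

theorem span_pair_sq (h k : MvPolynomial (Fin 4) K) : Submodule.span K (Set.range ![h, k]) ^ 2 =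
    Submodule.span K (Set.range (lineQuadrics h k)) := by
  rw [pow_two, Submodule.span_mul_span]
  congr 1
  ext p
  simp only [Set.mem_mul, Set.mem_range, lineQuadrics]
  constructor
  · rintro ⟨_, ⟨i, rfl⟩, _, ⟨j, rfl⟩, rfl⟩
    fin_cases i <;> fin_cases j
    · exact ⟨2, rfl⟩
    · exact ⟨1, rfl⟩
    · exact ⟨1, mul_comm _ _⟩
    · exact ⟨0, rfl⟩
  · rintro ⟨i, rfl⟩
    fin_cases i
    · exact ⟨k, ⟨1, rfl⟩, k, ⟨1, rfl⟩, rfl⟩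
    · exact ⟨h, ⟨0, rfl⟩, k, ⟨1, rfl⟩, rfl⟩
    · exact ⟨h, ⟨0, rfl⟩, h, ⟨0, rfl⟩, rfl⟩

theorem exists_linearIndependent_span_eq {V : Type*} [AddCommGroup V] [Module K V]
    {L : Submodule K V} {n : ℕ} (hL : Module.finrank K L = n + 1) :
    ∃ w : Fin (n + 1) → V, LinearIndependent K w ∧ Submodule.span K (Set.range w) = L := by
  have : Module.Finite K L := Module.finite_of_finrank_eq_succ hL
  let v := Module.finBasisOfFinrankEq K L hL
  refine ⟨L.subtype ∘ v, v.linearIndependent.map' _ L.ker_subtype, ?_⟩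
  rw [Set.range_comp, ← Submodule.map_span, v.span_eq, Submodule.map_top, Submodule.range_subtype]

theorem mem_lineSquareNets_iff {W : Submodule K (Form K 2)} :
    W ∈ lineSquareNets K ↔ ∃ h k : MvPolynomial (Fin 4) K, h.IsHomogeneous 1 ∧ k.IsHomogeneous 1 ∧
      LinearIndependent K ![h, k] ∧ W.map (homogeneousSubmodule (Fin 4) K 2).subtype =
        Submodule.span K (Set.range (lineQuadrics h k)) := by
  have hfun : ∀ h k : Form K 1, (homogeneousSubmodule (Fin 4) K 1).subtype ∘ ![h, k] =
      ![h.1, k.1] := fun h k => by funext i; fin_cases i <;> rfl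
  constructor
  · rintro ⟨L, hL, hW⟩
    obtain ⟨w, hli, rfl⟩ := exists_linearIndependent_span_eq hL
    obtain ⟨h, k, rfl⟩ : ∃ h k, w = ![h, k] := ⟨w 0, w 1, by funext i; fin_cases i <;> rfl⟩
    refine ⟨h.1, k.1, h.2, k.2, ?_, ?_⟩
    · rw [← hfun]
      exact hli.map' _ (Submodule.ker_subtype _)
    · rw [hW, ← span_pair_sq, Submodule.map_span, ← Set.range_comp, hfun]
  · rintro ⟨h, k, hh, hk, hli, hW⟩
    have e := hfun ⟨h, hh⟩ ⟨k, hk⟩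
    have hv : LinearIndependent K (![⟨h, hh⟩, ⟨k, hk⟩] : Fin 2 → Form K 1) :=
      LinearIndependent.of_comp (homogeneousSubmodule (Fin 4) K 1).subtype (by rw [e]; exact hli)
    refine ⟨Submodule.span K (Set.range ![⟨h, hh⟩, ⟨k, hk⟩]), ?_, ?_⟩
    · rw [finrank_span_eq_card hv]; rfl
    · rw [hW, ← span_pair_sq, Submodule.map_span, ← Set.range_comp, e]

end Lines

/-! ### Linear substitutions -/

section Substitution

variable {K : Type*} [Field K]

theorem linearIndependent_X_form : LinearIndependent K
    (fun i => ⟨X i, isHomogeneous_X K i⟩ : Fin 4 → Form K 1) :=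
  LinearIndependent.of_comp (homogeneousSubmodule (Fin 4) K 1).subtype
    (linearIndependent_X (Fin 4) K)

variable (K) in
/-- The basis `x₀, x₁, x₂, x₃` of the space of linear forms. -/
def formBasis : Module.Basis (Fin 4) K (Form K 1) :=
  Module.Basis.mk linearIndependent_X_form (by
    rintro ⟨f, hf⟩ -
    obtain ⟨c, rfl⟩ := exists_linear_expansion hf
    rw [Submodule.mem_span_range_iff_exists_fun]
    exact ⟨c, Subtype.ext (by simp [smul_eq_C_mul])⟩)

@[simp]
theorem coe_formBasis (i : Fin 4) : (formBasis K i : MvPolynomial (Fin 4) K) = X i := by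
  simp [formBasis]

/-- The endomorphism of the polynomial ring over a `K`-algebra `A` that extends a linear
substitution of the variables. -/
def substHom (A : Type*) [CommRing A] [Algebra K A] (e : Form K 1 ≃ₗ[K] Form K 1) :
    MvPolynomial (Fin 4) A →ₐ[A] MvPolynomial (Fin 4) A :=
  aeval fun i => map (algebraMap K A) (e (formBasis K i)).1

theorem substHom_coe (e : Form K 1 ≃ₗ[K] Form K 1) (f : Form K 1) : substHom K e f.1 = (e f).1 := by
  have : (substHom K e).toLinearMap ∘ₗ (homogeneousSubmodule (Fin 4) K 1).subtype =
      (homogeneousSubmodule (Fin 4) K 1).subtype ∘ₗ e.toLinearMap := by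
    refine (formBasis K).ext fun i => ?_
    simp [substHom, Algebra.algebraMap_self, MvPolynomial.map_id]
  exact LinearMap.congr_fun this f

theorem substHom_map {A : Type*} [CommRing A] [Algebra K A] (e : Form K 1 ≃ₗ[K] Form K 1)
    (p : MvPolynomial (Fin 4) K) :
    substHom A e (map (algebraMap K A) p) = map (algebraMap K A) (substHom K e p) := by
  induction p using MvPolynomial.induction_on with
  | C r => simp [substHom, algHom_C]
  | add p q hp hq => simp [hp, hq]
  | mul_X p i hp =>
    rw [map_mul, map_mul, hp]
    simp [substHom, Algebra.algebraMap_self, MvPolynomial.map_id]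

theorem substHom_symm (e : Form K 1 ≃ₗ[K] Form K 1) (p : MvPolynomial (Fin 4) K) :
    substHom K e.symm (substHom K e p) = p := by
  have : (substHom K e.symm).comp (substHom K e) = AlgHom.id K _ := by
    refine algHom_ext fun i => ?_
    have h1 : substHom K e (X i) = (e (formBasis K i)).1 := by
      rw [← substHom_coe, coe_formBasis]
    rw [AlgHom.comp_apply, h1, substHom_coe, LinearEquiv.symm_apply_apply, coe_formBasis]; rfl
  exact DFunLike.congr_fun this p

theorem substHom_isHomogeneous {A : Type*} [CommRing A] [Algebra K A] (e : Form K 1 ≃ₗ[K] Form K 1)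
    {p : MvPolynomial (Fin 4) A} {n : ℕ} (hp : p.IsHomogeneous n) :
    (substHom A e p).IsHomogeneous n := by
  have := hp.aeval (fun i => map (algebraMap K A) (e (formBasis K i)).1) (n := 1)
    fun i => ((mem_homogeneousSubmodule _ _).1 (e (formBasis K i)).2).map _
  rwa [one_mul] at this

/-- The action of a linear substitution on forms of degree `d`. -/
def substForm (d : ℕ) (e : Form K 1 ≃ₗ[K] Form K 1) : Form K d ≃ₗ[K] Form K d :=
  LinearEquiv.ofLinearMap
    ((substHom K e).toLinearMap.restrict fun _ hp => substHom_isHomogeneous e hp)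
    ((substHom K e.symm).toLinearMap.restrict fun _ hp => substHom_isHomogeneous e.symm hp)
    (LinearMap.ext fun f => Subtype.ext (substHom_symm e.symm f.1))
    (LinearMap.ext fun f => Subtype.ext (substHom_symm e f.1))

theorem coe_substForm {d : ℕ} (e : Form K 1 ≃ₗ[K] Form K 1) (f : Form K d) :
    (substForm d e f).1 = substHom K e f.1 := rfl

theorem map_map_substForm {d : ℕ} (e : Form K 1 ≃ₗ[K] Form K 1) (W : Submodule K (Form K d)) :
    (W.map (substForm d e).toLinearMap).map (homogeneousSubmodule (Fin 4) K d).subtype =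
      (W.map (homogeneousSubmodule (Fin 4) K d).subtype).map (substHom K e).toLinearMap := by
  rw [← Submodule.map_comp, ← Submodule.map_comp]
  rfl

theorem map_substForm_mem_detNets (e : Form K 1 ≃ₗ[K] Form K 1) {W : Submodule K (Form K 2)}
    (hW : W ∈ detNets K) : W.map (substForm 2 e).toLinearMap ∈ detNets K := by
  obtain ⟨h3, u, hu⟩ := hW
  refine ⟨?_, u.map (substForm 1 e), ?_⟩
  · rw [← h3]; exact LinearEquiv.finrank_map_eq _ _
  · rw [map_map_substForm, hu, Submodule.map_span, ← Set.range_comp]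
    congr 2
    funext i
    change substHom K e (Matrix.det _) = _
    rw [AlgHom.map_det]
    rfl

theorem map_substForm_mem_lineSquareNets (e : Form K 1 ≃ₗ[K] Form K 1) {W : Submodule K (Form K 2)}
    (hW : W ∈ lineSquareNets K) : W.map (substForm 2 e).toLinearMap ∈ lineSquareNets K := by
  rw [mem_lineSquareNets_iff] at hW ⊢
  obtain ⟨h, k, hh, hk, hli, hW⟩ := hW
  refine ⟨substHom K e h, substHom K e k, substHom_isHomogeneous e hh,
    substHom_isHomogeneous e hk, ?_, ?_⟩
  · have hfun : (substHom K e).toLinearMap ∘ ![h, k] = ![substHom K e h, substHom K e k] := by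
      funext i; fin_cases i <;> rfl
    rw [← hfun]
    exact hli.map' _ (LinearMap.ker_eq_bot.2 (Function.LeftInverse.injective (substHom_symm e)))
  · rw [map_map_substForm, hW, Submodule.map_span, ← Set.range_comp]
    congr 2
    funext i; fin_cases i <;> simp [lineQuadrics]

theorem gen_map_substForm (b : Module.Basis (Fin 3 ⊕ Fin 7) K (Form K 2)) {A : Type*} [CommRing A]
    [Algebra K A] (e : Form K 1 ≃ₗ[K] Form K 1) (a : Fin 3 × Fin 7 → A) (i : Fin 3) :
    gen (b.map (substForm 2 e)) a i = substHom A e (gen b a i) := by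
  simp only [gen, Module.Basis.map_apply, coe_substForm, map_add, map_sum, map_smul, substHom_map]

theorem chartNet_map_substForm (b : Module.Basis (Fin 3 ⊕ Fin 7) K (Form K 2))
    (e : Form K 1 ≃ₗ[K] Form K 1) (a : Fin 3 × Fin 7 → K) :
    chartNet (b.map (substForm 2 e)) a = (chartNet b a).map (substForm 2 e).toLinearMap := by
  refine Submodule.map_injective_of_injective Subtype.val_injective
    (f := (homogeneousSubmodule (Fin 4) K 2).subtype) ?_
  rw [map_chartNet, map_map_substForm, map_chartNet, Submodule.map_span, ← Set.range_comp]
  congr 2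
  funext i
  exact gen_map_substForm b e a i

theorem map_symm_substForm (e : Form K 1 ≃ₗ[K] Form K 1) (W : Submodule K (Form K 2)) :
    (W.map (substForm 2 e).toLinearMap).map (substForm 2 e.symm).toLinearMap = W := by
  have h1 : (substForm 2 e.symm).toLinearMap ∘ₗ (substForm 2 e).toLinearMap = LinearMap.id :=
    LinearMap.ext fun f => Subtype.ext (substHom_symm e f.1)
  rw [← Submodule.map_comp, h1, Submodule.map_id]

/-- The ideal of an invariant subvariety in a chart does not change when the chart is moved by a
linear substitution. -/
theorem chartIdeal_map_substForm (b : Module.Basis (Fin 3 ⊕ Fin 7) K (Form K 2))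
    (e : Form K 1 ≃ₗ[K] Form K 1) {S : Set (Submodule K (Form K 2))}
    (hS : ∀ (e : Form K 1 ≃ₗ[K] Form K 1) {W : Submodule K (Form K 2)}, W ∈ S →
      W.map (substForm 2 e).toLinearMap ∈ S) :
    chartIdeal (b.map (substForm 2 e)) S = chartIdeal b S := by
  have key : ∀ a : Fin 3 × Fin 7 → K,
      chartNet (b.map (substForm 2 e)) a ∈ S ↔ chartNet b a ∈ S := by
    intro a
    rw [chartNet_map_substForm]
    refine ⟨fun h => ?_, fun h => hS e h⟩
    have h' := hS e.symm h
    rwa [map_symm_substForm] at h'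
  exact congrArg (vanishingIdeal K) (Set.ext key)

/-- Any two independent linear forms can be moved to `x₀` and `x₁`. -/
theorem exists_substHom_eq {h k : MvPolynomial (Fin 4) K} (hh : h.IsHomogeneous 1)
    (hk : k.IsHomogeneous 1) (hli : LinearIndependent K ![h, k]) :
    ∃ e : Form K 1 ≃ₗ[K] Form K 1, substHom K e h = X 0 ∧ substHom K e k = X 1 := by
  have hfun : (homogeneousSubmodule (Fin 4) K 1).subtype ∘
      (![⟨h, hh⟩, ⟨k, hk⟩] : Fin 2 → Form K 1) = ![h, k] := by
    funext i; fin_cases i <;> rfl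
  have hv : LinearIndependent K (![⟨h, hh⟩, ⟨k, hk⟩] : Fin 2 → Form K 1) :=
    LinearIndependent.of_comp (homogeneousSubmodule (Fin 4) K 1).subtype (by rw [hfun]; exact hli)
  have hfr : Module.finrank K (Form K 1) = 4 := by
    rw [Module.finrank_eq_card_basis (formBasis K)]; rfl
  obtain ⟨x, hx⟩ := exists_linearIndependent_snoc_of_lt_finrank hv (by rw [hfr]; norm_num)
  obtain ⟨y, hy⟩ := exists_linearIndependent_snoc_of_lt_finrank hx (by rw [hfr]; norm_num)
  let B := basisOfLinearIndependentOfCardEqFinrank hy (by rw [hfr]; rfl)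
  let e := B.equiv (formBasis K) (Equiv.refl _)
  have he : ∀ i, e (B i) = formBasis K i := fun i => by simp [e]
  have hB0 : B 0 = ⟨h, hh⟩ := by
    rw [coe_basisOfLinearIndependentOfCardEqFinrank]; rfl
  have hB1 : B 1 = ⟨k, hk⟩ := by
    rw [coe_basisOfLinearIndependentOfCardEqFinrank]; rfl
  refine ⟨e, ?_, ?_⟩
  · have := substHom_coe e ⟨h, hh⟩
    rw [← hB0, he, coe_formBasis, hB0] at this
    exact this
  · have := substHom_coe e ⟨k, hk⟩
    rw [← hB1, he, coe_formBasis, hB1] at this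
    exact this

end Substitution

/-! ### The equations of determinantal nets near `(x₀, x₁)²` -/

section Graph

variable {A : Type*} [CommRing A]

/-- The coefficients of `x₁²`, `x₀ x₁`, `x₀²` in a quadratic form. -/
def pureCoef (p : MvPolynomial (Fin 4) A) : Fin 3 → A := ![coef 1 1 p, coef 0 1 p, coef 0 0 p]

/-- A triple of quadratic forms that restricts to `δ x₁², δ x₀ x₁, δ x₀²` on `x₂ = x₃ = 0`. -/
structure IsNormalized (δ : A) (q : Fin 3 → MvPolynomial (Fin 4) A) : Prop where
  isHomogeneous : ∀ i, (q i).IsHomogeneous 2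
  pureCoef_eq : ∀ i, pureCoef (q i) = Pi.single i δ

/-- The coefficient of `x_j x_l` in the product of two linear forms. -/
def prodCoef (x y : Fin 4 → A) (j l : Fin 4) : A :=
  if j = l then x j * y j else x j * y l + x l * y j

/-- The equations of the variety of determinantal nets near the net `(x₀, x₁)²`: in a normalized
triple, the coefficients of the monomials in `x₂, x₃` are polynomials in the coefficients of the
mixed monomials. They result from the elimination of the linear syzygies, see
`IsNormalized.syzygy`, and are homogeneous of degree two in `δ` and the coefficients. -/
def graphEq (δ : A) (q : Fin 3 → MvPolynomial (Fin 4) A) (j l : Fin 4) : Fin 3 → A :=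
  ![δ * coef j l (q 0) -
      (prodCoef (fun i => coef 1 i (q 0) - coef 0 i (q 1)) (fun i => coef 0 i (q 1)) j l +
        prodCoef (fun i => coef 0 i (q 0)) (fun i => coef 0 i (q 2) - coef 1 i (q 1)) j l),
    δ * coef j l (q 1) -
      (prodCoef (fun i => coef 1 i (q 1)) (fun i => coef 0 i (q 1)) j l -
        prodCoef (fun i => coef 0 i (q 0)) (fun i => coef 1 i (q 2)) j l),
    δ * coef j l (q 2) -
      (prodCoef (fun i => coef 1 i (q 1)) (fun i => coef 0 i (q 2) - coef 1 i (q 1)) j l +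
        prodCoef (fun i => coef 1 i (q 2)) (fun i => coef 1 i (q 0) - coef 0 i (q 1)) j l)]

theorem IsNormalized.coef_eq {δ : A} {q : Fin 3 → MvPolynomial (Fin 4) A} (hq : IsNormalized δ q) :
    (coef 1 1 (q 0) = δ ∧ coef 0 1 (q 0) = 0 ∧ coef 0 0 (q 0) = 0) ∧
    (coef 1 1 (q 1) = 0 ∧ coef 0 1 (q 1) = δ ∧ coef 0 0 (q 1) = 0) ∧
    (coef 1 1 (q 2) = 0 ∧ coef 0 1 (q 2) = 0 ∧ coef 0 0 (q 2) = δ) := by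
  have h := fun i k => congrFun (hq.pureCoef_eq i) k
  exact ⟨⟨by simpa [pureCoef] using h 0 0, by simpa [pureCoef] using h 0 1,
    by simpa [pureCoef] using h 0 2⟩, ⟨by simpa [pureCoef] using h 1 0,
    by simpa [pureCoef] using h 1 1, by simpa [pureCoef] using h 1 2⟩,
    ⟨by simpa [pureCoef] using h 2 0, by simpa [pureCoef] using h 2 1,
    by simpa [pureCoef] using h 2 2⟩⟩

end Graph

section Syzygies

variable {K : Type*} [Field K] [CharZero K] {δ : K} {q : Fin 3 → MvPolynomial (Fin 4) K}

/-- A linear syzygy of a normalized triple is determined by two of its coefficients, `S 0 0` and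
`S 1 0`, and these are the coefficients of a linear relation between the equations of the graph. -/
theorem IsNormalized.syzygy (hq : IsNormalized δ q) (hδ : δ ≠ 0) {S : Fin 3 → Fin 4 → K}
    (hS : ∑ k, (∑ n, C (S k n) * X n) * q k = 0) :
    (S 0 0 = 0 → S 1 0 = 0 → S = 0) ∧
    ∀ jl ∈ ({(2, 2), (2, 3), (3, 3)} : Set (Fin 4 × Fin 4)),
      S 0 0 * graphEq δ q jl.1 jl.2 0 + S 1 0 * graphEq δ q jl.1 jl.2 1 = 0 ∧
      S 0 0 * graphEq δ q jl.1 jl.2 1 + S 1 0 * graphEq δ q jl.1 jl.2 2 = 0 := by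
  obtain ⟨⟨n1, n2, n3⟩, ⟨n4, n5, n6⟩, n7, n8, n9⟩ := hq.coef_eq
  -- Below, the coefficients of the cubic form on the left of `hS` are obtained by interpolation
  -- from its values at points with coordinates `0`, `1`, `-1`.
  have h : ∀ x0 x1 x2 x3 : K, _ := fun x0 x1 x2 x3 => congrArg (eval ![x0, x1, x2, x3]) hS
  rw [Fin.sum_univ_three, quadratic_expansion (hq.isHomogeneous 0),
    quadratic_expansion (hq.isHomogeneous 1), quadratic_expansion (hq.isHomogeneous 2)] at h
  simp only [n1, n2, n3, n4, n5, n6, n7, n8, n9, Fin.sum_univ_four, map_add, map_mul, eval_C,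
    eval_X, map_pow, map_zero, Matrix.cons_val] at h
  -- The monomials `x₁³`, `x₀³`, `x₀ x₁²`, `x₀² x₁`.
  have a1 : S 0 1 = 0 := by
    refine (mul_eq_zero.1 (?_ : δ * S 0 1 = 0)).resolve_left hδ
    linear_combination h 0 1 0 0
  have a2 : S 2 0 = 0 := by
    refine (mul_eq_zero.1 (?_ : δ * S 2 0 = 0)).resolve_left hδ
    linear_combination h 1 0 0 0
  have a3 : S 1 1 = -S 0 0 := by
    refine sub_eq_zero.1 ((mul_eq_zero.1 (?_ : δ * (S 1 1 - -S 0 0) = 0)).resolve_left hδ)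
    linear_combination (h 1 1 0 0 - h (-1) 1 0 0) / 2 - h 1 0 0 0
  have a4 : S 2 1 = -S 1 0 := by
    refine sub_eq_zero.1 ((mul_eq_zero.1 (?_ : δ * (S 2 1 - -S 1 0) = 0)).resolve_left hδ)
    linear_combination (h 1 1 0 0 + h (-1) 1 0 0) / 2 - h 0 1 0 0
  rw [a1, a2, a3, a4] at h
  -- The monomials `x_i x_j x_l` with `i, j ≤ 1` and `l ≥ 2` give the other coefficients of `S`.
  have b02 : δ * S 0 2 = S 0 0 * coef 1 2 (q 1) + S 1 0 * coef 1 2 (q 2) := by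
    linear_combination (h 0 1 1 0 + h 0 (-1) 1 0) / 2 - h 0 0 1 0
  have b03 : δ * S 0 3 = S 0 0 * coef 1 3 (q 1) + S 1 0 * coef 1 3 (q 2) := by
    linear_combination (h 0 1 0 1 + h 0 (-1) 0 1) / 2 - h 0 0 0 1
  have b22 : δ * S 2 2 = -(S 0 0 * coef 0 2 (q 0) + S 1 0 * coef 0 2 (q 1)) := by
    linear_combination (h 1 0 1 0 + h (-1) 0 1 0) / 2 - h 0 0 1 0
  have b23 : δ * S 2 3 = -(S 0 0 * coef 0 3 (q 0) + S 1 0 * coef 0 3 (q 1)) := by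
    linear_combination (h 1 0 0 1 + h (-1) 0 0 1) / 2 - h 0 0 0 1
  have b12 : δ * S 1 2 = S 0 0 * (coef 0 2 (q 1) - coef 1 2 (q 0)) +
      S 1 0 * (coef 0 2 (q 2) - coef 1 2 (q 1)) := by
    linear_combination h 1 1 1 0 - h 1 1 0 0 - h 1 0 1 0 - h 0 1 1 0 +
      h 1 0 0 0 + h 0 1 0 0 + h 0 0 1 0
  have b13 : δ * S 1 3 = S 0 0 * (coef 0 3 (q 1) - coef 1 3 (q 0)) +
      S 1 0 * (coef 0 3 (q 2) - coef 1 3 (q 1)) := by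
    linear_combination h 1 1 0 1 - h 1 1 0 0 - h 1 0 0 1 - h 0 1 0 1 +
      h 1 0 0 0 + h 0 1 0 0 + h 0 0 0 1
  constructor
  · intro h0 h1
    have z : ∀ k n, δ * S k n = 0 → S k n = 0 := fun k n h => (mul_eq_zero.1 h).resolve_left hδ
    rw [h0, h1] at b02 b03 b22 b23 b12 b13
    rw [h0] at a3
    rw [h1] at a4
    simp only [zero_mul, add_zero, neg_zero] at b02 b03 b22 b23 b12 b13 a3 a4
    funext k n
    fin_cases k <;> fin_cases n
    exacts [h0, a1, z _ _ b02, z _ _ b03, h1, a3, z _ _ b12, z _ _ b13, a2, a4, z _ _ b22,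
      z _ _ b23]
  · -- The monomials `x_i x_j x_l` with `i ≤ 1` and `j, l ≥ 2` give the relations.
    rintro ⟨j, l⟩ hjl
    simp only [Set.mem_insert_iff, Set.mem_singleton_iff] at hjl
    rcases hjl with hjl | hjl | hjl <;> obtain ⟨rfl, rfl⟩ := Prod.mk.inj hjl <;>
      simp only [graphEq, prodCoef, Matrix.cons_val, Fin.reduceEq, if_true, if_false]
    · constructor
      · linear_combination δ * ((h 1 0 1 0 + h 1 0 (-1) 0) / 2 - h 1 0 0 0) -
          coef 0 2 (q 0) * b02 - coef 0 2 (q 1) * b12 - coef 0 2 (q 2) * b22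
      · linear_combination -δ * ((h 0 1 1 0 + h 0 1 (-1) 0) / 2 - h 0 1 0 0) +
          coef 1 2 (q 0) * b02 + coef 1 2 (q 1) * b12 + coef 1 2 (q 2) * b22
    · constructor
      · linear_combination δ * (h 1 0 1 1 - h 1 0 1 0 - h 1 0 0 1 - h 0 0 1 1 + h 1 0 0 0 +
            h 0 0 1 0 + h 0 0 0 1) -
          coef 0 2 (q 0) * b03 - coef 0 2 (q 1) * b13 - coef 0 2 (q 2) * b23 -
          coef 0 3 (q 0) * b02 - coef 0 3 (q 1) * b12 - coef 0 3 (q 2) * b22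
      · linear_combination -δ * (h 0 1 1 1 - h 0 1 1 0 - h 0 1 0 1 - h 0 0 1 1 + h 0 1 0 0 +
            h 0 0 1 0 + h 0 0 0 1) +
          coef 1 2 (q 0) * b03 + coef 1 2 (q 1) * b13 + coef 1 2 (q 2) * b23 +
          coef 1 3 (q 0) * b02 + coef 1 3 (q 1) * b12 + coef 1 3 (q 2) * b22
    · constructor
      · linear_combination δ * ((h 1 0 0 1 + h 1 0 0 (-1)) / 2 - h 1 0 0 0) -
          coef 0 3 (q 0) * b03 - coef 0 3 (q 1) * b13 - coef 0 3 (q 2) * b23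
      · linear_combination -δ * ((h 0 1 0 1 + h 0 1 0 (-1)) / 2 - h 0 1 0 0) +
          coef 1 3 (q 0) * b03 + coef 1 3 (q 1) * b13 + coef 1 3 (q 2) * b23

end Syzygies

section Determinantal

variable {K : Type*} [Field K]

/-- Two families with the same span, one of them independent, are related by inverse matrices. -/
theorem exists_inverse_matrices {V : Type*} [AddCommGroup V] [Module K V] {n : ℕ} {w w' : Fin n → V}
    (hw : LinearIndependent K w)
    (h : Submodule.span K (Set.range w) = Submodule.span K (Set.range w')) :
    ∃ T T' : Matrix (Fin n) (Fin n) K, T * T' = 1 ∧ T' * T = 1 ∧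
      (∀ i, w i = ∑ k, T i k • w' k) ∧ (∀ i, w' i = ∑ k, T' i k • w k) := by
  have h1 : ∀ i, w i ∈ Submodule.span K (Set.range w') := fun i =>
    h ▸ Submodule.subset_span ⟨i, rfl⟩
  have h2 : ∀ i, w' i ∈ Submodule.span K (Set.range w) := fun i =>
    h ▸ Submodule.subset_span ⟨i, rfl⟩
  choose T hT using fun i => (Submodule.mem_span_range_iff_exists_fun K).1 (h1 i)
  choose T' hT' using fun i => (Submodule.mem_span_range_iff_exists_fun K).1 (h2 i)
  have hmul : Matrix.of T * Matrix.of T' = 1 := by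
    ext i j
    have hi : ∑ j, ((Matrix.of T * Matrix.of T') i j -
        (1 : Matrix (Fin n) (Fin n) K) i j) • w j = 0 := by
      simp only [sub_smul, Finset.sum_sub_distrib, Matrix.one_apply, ite_smul, one_smul, zero_smul,
        Finset.sum_ite_eq, Finset.mem_univ, if_true, Matrix.mul_apply, Matrix.of_apply,
        Finset.sum_smul]
      rw [Finset.sum_comm, sub_eq_zero]
      simp only [mul_smul, ← Finset.smul_sum, hT', hT]
    exact sub_eq_zero.1 (Fintype.linearIndependent_iff.1 hw _ hi j)
  exact ⟨Matrix.of T, Matrix.of T', hmul, mul_eq_one_comm.1 hmul, fun i => (hT i).symm,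
    fun i => (hT' i).symm⟩

/-- The minors of a `3 × 2` matrix of linear forms with independent minors satisfy the equations of
the graph after a normalization: the two columns of the matrix give two independent linear
syzygies. -/
theorem IsNormalized.graphEq_eq_zero [CharZero K] {δ : K} {q : Fin 3 → MvPolynomial (Fin 4) K}
    (hq : IsNormalized δ q) (hδ : δ ≠ 0) (hli : LinearIndependent K q)
    {u : Matrix (Fin 3) (Fin 2) (Form K 1)}
    (hu : Submodule.span K (Set.range q) = Submodule.span K (Set.range fun i : Fin 3 =>
      ((u.map fun l => (l : MvPolynomial (Fin 4) K)).submatrix i.succAbove id).det))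
    {j l : Fin 4} (hjl : (j, l) ∈ ({(2, 2), (2, 3), (3, 3)} : Set (Fin 4 × Fin 4))) (i : Fin 3) :
    graphEq δ q j l i = 0 := by
  set m := fun i : Fin 3 =>
      ((u.map fun l => (l : MvPolynomial (Fin 4) K)).submatrix i.succAbove id).det with hm
  obtain ⟨T', T, hTT', hTT, hqm, hmq⟩ := exists_inverse_matrices hli hu
  have hmi : LinearIndependent K m :=
    linearIndependent_of_mem_span hli fun i => hu ▸ Submodule.subset_span ⟨i, rfl⟩
  have m0 : m 0 = (u 1 0).1 * (u 2 1).1 - (u 1 1).1 * (u 2 0).1 := by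
    simp [hm, Matrix.det_fin_two, Fin.succAbove]
  have m1 : m 1 = (u 0 0).1 * (u 2 1).1 - (u 0 1).1 * (u 2 0).1 := by
    simp [hm, Matrix.det_fin_two, Fin.succAbove]
  have m2 : m 2 = (u 0 0).1 * (u 1 1).1 - (u 0 1).1 * (u 1 0).1 := by
    simp [hm, Matrix.det_fin_two, Fin.succAbove]
  -- `v i j` is the entry of `u` with the sign of the cofactor expansion.
  let v : Fin 3 → Fin 2 → Form K 1 := ![u 0, -u 1, u 2]
  have hv : ∀ j, ∑ i, (v i j).1 * m i = 0 := by
    intro j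
    rw [Fin.sum_univ_three, m0, m1, m2]
    fin_cases j <;> simp [v] <;> ring
  choose S hS using fun k j => exists_linear_expansion
    ((mem_homogeneousSubmodule _ _).1 (∑ i, T i k • v i j).2)
  have hsyz : ∀ j, ∑ k, (∑ n, C (S k j n) * X n) * q k = 0 := by
    intro j
    rw [← hv j]
    simp only [← hS, hmq, Submodule.coe_sum, Submodule.coe_smul, Finset.sum_mul, Finset.mul_sum]
    rw [Finset.sum_comm]
    refine Finset.sum_congr rfl fun i _ => Finset.sum_congr rfl fun k _ => ?_
    rw [smul_mul_assoc, mul_smul_comm]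
  -- The two syzygies are independent.
  have hind : ∀ x y : K, (∀ k n, x * S k 0 n + y * S k 1 n = 0) → x = 0 ∧ y = 0 := by
    intro x y hxy
    have h1 : ∀ k, ∑ i, T i k • (x • (v i 0).1 + y • (v i 1).1) = 0 := by
      intro k
      have : ∑ i, T i k • (x • (v i 0).1 + y • (v i 1).1) =
          x • (∑ i, T i k • v i 0 : Form K 1).1 + y • (∑ i, T i k • v i 1 : Form K 1).1 := by
        simp only [Submodule.coe_sum, Submodule.coe_smul, smul_add, Finset.sum_add_distrib,
          Finset.smul_sum, smul_comm x, smul_comm y]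
      rw [this, hS, hS, Finset.smul_sum, Finset.smul_sum, ← Finset.sum_add_distrib]
      refine Finset.sum_eq_zero fun n _ => ?_
      rw [smul_eq_C_mul, smul_eq_C_mul, ← mul_assoc, ← mul_assoc, ← C_mul, ← C_mul, ← add_mul,
        ← C_add, hxy, C_0, zero_mul]
    have h2 : ∀ i, x • (v i 0).1 + y • (v i 1).1 = 0 := by
      intro i
      have h3 : ∑ k, T' k i • ∑ i', T i' k • (x • (v i' 0).1 + y • (v i' 1).1) = 0 :=
        Finset.sum_eq_zero fun k _ => by rw [h1, smul_zero]
      simp only [Finset.smul_sum, smul_smul] at h3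
      rw [Finset.sum_comm] at h3
      simp only [← Finset.sum_smul] at h3
      have h4 : ∀ i', ∑ k, T' k i * T i' k = (1 : Matrix (Fin 3) (Fin 3) K) i' i := by
        intro i'
        rw [← hTT, Matrix.mul_apply]
        exact Finset.sum_congr rfl fun k _ => mul_comm _ _
      simpa only [h4, Matrix.one_apply, ite_smul, one_smul, zero_smul, Finset.sum_ite_eq',
        Finset.mem_univ, if_true] using h3
    have h0 := h2 0
    have h1' := h2 1
    simp only [v, Matrix.cons_val, smul_eq_C_mul, Pi.neg_apply, Submodule.coe_neg] at h0 h1'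
    have hm2 : m 2 ≠ 0 := hmi.ne_zero 2
    have hx : C x * m 2 = 0 := by
      rw [m2]; linear_combination (u 1 1).1 * h0 + (u 0 1).1 * h1'
    have hy : C y * m 2 = 0 := by
      rw [m2]; linear_combination -(u 1 0).1 * h0 - (u 0 0).1 * h1'
    exact ⟨by simpa [hm2] using hx, by simpa [hm2] using hy⟩
  obtain ⟨z0, r0⟩ := hq.syzygy hδ (hsyz 0)
  obtain ⟨z1, r1⟩ := hq.syzygy hδ (hsyz 1)
  have hdet : S 0 0 0 * S 1 1 0 - S 0 1 0 * S 1 0 0 ≠ 0 := by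
    intro hdet
    -- Otherwise some combination of the syzygies has vanishing leading coefficients.
    have hcomb : ∀ x y : K, x * S 0 0 0 + y * S 0 1 0 = 0 → x * S 1 0 0 + y * S 1 1 0 = 0 →
        x = 0 ∧ y = 0 := by
      intro x y e0 e1
      refine hind x y fun k n => ?_
      have hs : ∑ k, (∑ n, C (x * S k 0 n + y * S k 1 n) * X n) * q k = 0 := by
        have : ∑ k, (∑ n, C (x * S k 0 n + y * S k 1 n) * X n) * q k =
            C x * ∑ k, (∑ n, C (S k 0 n) * X n) * q k +
              C y * ∑ k, (∑ n, C (S k 1 n) * X n) * q k := by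
          rw [Finset.mul_sum, Finset.mul_sum, ← Finset.sum_add_distrib]
          refine Finset.sum_congr rfl fun k _ => ?_
          rw [← mul_assoc, ← mul_assoc, ← add_mul, Finset.mul_sum, Finset.mul_sum,
            ← Finset.sum_add_distrib]
          refine congrArg (· * q k) (Finset.sum_congr rfl fun n _ => ?_)
          rw [C_add, C_mul, C_mul]; ring
        rw [this, hsyz, hsyz, mul_zero, mul_zero, add_zero]
      exact congrFun (congrFun ((hq.syzygy hδ hs).1 e0 e1) k) n
    obtain ⟨h1, h2⟩ := hcomb (S 0 1 0) (-S 0 0 0) (by ring) (by linear_combination -hdet)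
    obtain ⟨h3, h4⟩ := hcomb (S 1 1 0) (-S 1 0 0) (by linear_combination hdet) (by ring)
    exact one_ne_zero
      (hcomb 1 0 (by rw [neg_eq_zero.1 h2]; ring) (by rw [neg_eq_zero.1 h4]; ring)).1
  obtain ⟨a1, a2⟩ := r0 _ hjl
  obtain ⟨b1, b2⟩ := r1 _ hjl
  have g : ∀ x, (S 0 0 0 * S 1 1 0 - S 0 1 0 * S 1 0 0) * x = 0 → x = 0 := fun x hx =>
    (mul_eq_zero.1 hx).resolve_left hdet
  obtain rfl | rfl | rfl := (by decide : ∀ i : Fin 3, i = 0 ∨ i = 1 ∨ i = 2) i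
  · exact g _ (by linear_combination S 1 1 0 * a1 - S 1 0 0 * b1)
  · exact g _ (by linear_combination S 0 0 0 * b1 - S 0 1 0 * a1)
  · exact g _ (by linear_combination S 0 0 0 * b2 - S 0 1 0 * a2)

end Determinantal

/-! ### The linear equations contained in the minors -/

section LineEquations

variable {A : Type*} [CommRing A] {q : Fin 3 → MvPolynomial (Fin 4) A}

/-- The restriction of a form to `x₂ = x₃ = 0`, dehomogenized by `x₁ = 1`. -/
def restrict : MvPolynomial (Fin 4) A →ₐ[A] Polynomial A := aeval ![Polynomial.X, 1, 0, 0]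

theorem IsNormalized.restrict_eq (hq : IsNormalized 1 q) (i : Fin 3) :
    restrict (q i) = Polynomial.X ^ (i : ℕ) := by
  obtain ⟨⟨n1, n2, n3⟩, ⟨n4, n5, n6⟩, n7, n8, n9⟩ := hq.coef_eq
  rw [quadratic_expansion (hq.isHomogeneous i)]
  obtain rfl | rfl | rfl := (by decide : ∀ i : Fin 3, i = 0 ∨ i = 1 ∨ i = 2) i <;>
    simp [restrict, *]

theorem restrict_pderiv {p : MvPolynomial (Fin 4) A} (hp : p.IsHomogeneous 2) {y : Fin 4}
    (hy : y = 2 ∨ y = 3) :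
    restrict (pderiv y p) =
      Polynomial.C (coef 1 y p) + Polynomial.C (coef 0 y p) * Polynomial.X := by
  conv_lhs => rw [quadratic_expansion hp]
  obtain rfl | rfl := hy <;>
    simp [restrict, pderiv_X, Derivation.leibniz] <;> ring

/-- For a normalized triple `q₀, q₁, q₂`, the five products other than `q₀ q₂` have independent
restrictions to `x₂ = x₃ = 0`, and the restriction of `q₀ q₂ - q₁²` vanishes. So a minor that
involves the five monomials in `x₀, x₁` reduces to a single coefficient of `q₀ q₂ - q₁²`. -/
theorem IsNormalized.coeff_relation_eq_zero (hq : IsNormalized 1 q)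
    (hV : MinorsVanish (Submodule.span A (Set.range q))) (y : Fin 4) (n : ℕ) :
    (restrict (pderiv y (q 0 * q 2 - q 1 * q 1))).coeff n = 0 := by
  have hm : ∀ i, q i ∈ Submodule.span A (Set.range q) := fun i => Submodule.subset_span ⟨i, rfl⟩
  let w : Fin 6 → MvPolynomial (Fin 4) A :=
    ![q 0 * q 0, q 0 * q 1, q 1 * q 1, q 1 * q 2, q 2 * q 2, q 0 * q 2 - q 1 * q 1]
  have hw : ∀ j, w j ∈ Submodule.span A (Set.range q) * Submodule.span A (Set.range q) := by
    have hmul := fun i j => Submodule.mul_mem_mul (hm i) (hm j)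
    intro j
    fin_cases j
    exacts [hmul 0 0, hmul 0 1, hmul 1 1, hmul 1 2, hmul 2 2, sub_mem (hmul 0 2) (hmul 1 1)]
  let g : Fin 6 → (MvPolynomial (Fin 4) A →ₗ[A] A) := fun i =>
    if i = 5 then Polynomial.lcoeff A n ∘ₗ restrict.toLinearMap ∘ₗ (pderiv y).toLinearMap
    else Polynomial.lcoeff A i ∘ₗ restrict.toLinearMap
  have hg5 : ∀ p, g 5 p = (restrict (pderiv y p)).coeff n := fun p => rfl
  have hg : ∀ i, i ≠ 5 → ∀ p, g i p = (restrict p).coeff i := by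
    intro i hi p
    simp [g, hi]
  have hr : ∀ j, j ≠ 5 → restrict (w j) = Polynomial.X ^ (j : ℕ) := by
    intro j hj
    have h0 := hq.restrict_eq 0
    have h1 := hq.restrict_eq 1
    have h2 := hq.restrict_eq 2
    fin_cases j <;> simp [w, h0, h1, h2] at hj ⊢ <;> ring
  have hr5 : restrict (w 5) = 0 := by
    have h0 := hq.restrict_eq 0
    have h1 := hq.restrict_eq 1
    have h2 := hq.restrict_eq 2
    simp [w, h0, h1, h2]
    ring
  -- The matrix of this minor is triangular, with ones on the diagonal up to the last place.
  have hdet := hV w hw g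
  have htri : (Matrix.of fun j i => g i (w j)).BlockTriangular id := by
    intro j i hij
    simp only [id] at hij
    have hi : i ≠ 5 := by rintro rfl; omega
    rw [Matrix.of_apply, hg i hi]
    by_cases hj : j = 5
    · rw [hj, hr5, Polynomial.coeff_zero]
    · rw [hr j hj, Polynomial.coeff_X_pow, if_neg]
      intro h; omega
  rw [Matrix.det_of_isUpperTriangular htri, Fin.prod_univ_succAbove _ 5,
    Finset.prod_eq_one, mul_one] at hdet
  · exact hdet
  · intro i _
    have hi : Fin.succAbove 5 i ≠ 5 := Fin.succAbove_ne 5 i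
    rw [Matrix.of_apply, hg _ hi, hr _ hi, Polynomial.coeff_X_pow, if_pos rfl]

/-- A normalized triple that satisfies the equations of the graph and the vanishing of the minors
consists of the products of two linear forms, over any base ring. This is the scheme-theoretic
core: the minors contain the linear equations of the net `(L)²` in the affine space of
determinantal nets. -/
theorem IsNormalized.eq_lineQuadrics (hq : IsNormalized 1 q)
    (hV : MinorsVanish (Submodule.span A (Set.range q)))
    (hG : ∀ jl ∈ ({(2, 2), (2, 3), (3, 3)} : Set (Fin 4 × Fin 4)), ∀ i,
      graphEq 1 q jl.1 jl.2 i = 0) :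
    q = lineQuadrics (X 0 + C (coef 1 2 (q 1)) * X 2 + C (coef 1 3 (q 1)) * X 3)
      (X 1 + C (coef 0 2 (q 1)) * X 2 + C (coef 0 3 (q 1)) * X 3) := by
  have key : ∀ y : Fin 4, y = 2 ∨ y = 3 → coef 1 y (q 2) = 0 ∧ coef 0 y (q 0) = 0 ∧
      coef 0 y (q 2) = 2 * coef 1 y (q 1) ∧ coef 1 y (q 0) = 2 * coef 0 y (q 1) := by
    intro y hy
    have h := hq.coeff_relation_eq_zero hV y
    have h0 := hq.restrict_eq 0
    have h1 := hq.restrict_eq 1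
    have h2 := hq.restrict_eq 2
    have hexp : restrict (pderiv y (q 0 * q 2 - q 1 * q 1)) =
        Polynomial.C (coef 1 y (q 2)) +
        Polynomial.C (coef 0 y (q 2) - 2 * coef 1 y (q 1)) * Polynomial.X +
        Polynomial.C (coef 1 y (q 0) - 2 * coef 0 y (q 1)) * Polynomial.X ^ 2 +
        Polynomial.C (coef 0 y (q 0)) * Polynomial.X ^ 3 := by
      simp only [map_sub, Derivation.leibniz, smul_eq_mul, map_add, map_mul, h0, h1, h2,
        restrict_pderiv (hq.isHomogeneous _) hy, Fin.val_zero, Fin.val_one, Fin.val_two]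
      simp only [map_ofNat]
      ring
    rw [hexp] at h
    have c0 := h 0; have c1 := h 1; have c2 := h 2; have c3 := h 3
    simp only [Polynomial.coeff_add, Polynomial.coeff_C_mul, Polynomial.coeff_X,
      Polynomial.coeff_X_pow, Polynomial.coeff_C] at c0 c1 c2 c3
    norm_num at c0 c1 c2 c3
    exact ⟨c0, c3, sub_eq_zero.1 c1, sub_eq_zero.1 c2⟩
  obtain ⟨⟨n1, n2, n3⟩, ⟨n4, n5, n6⟩, n7, n8, n9⟩ := hq.coef_eq
  obtain ⟨a1, a2, a3, a4⟩ := key 2 (Or.inl rfl)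
  obtain ⟨b1, b2, b3, b4⟩ := key 3 (Or.inr rfl)
  have g22 := hG (2, 2) (by simp)
  have g23 := hG (2, 3) (by simp)
  have g33 := hG (3, 3) (by simp)
  have g220 := g22 0; have g221 := g22 1; have g222 := g22 2
  have g230 := g23 0; have g231 := g23 1; have g232 := g23 2
  have g330 := g33 0; have g331 := g33 1; have g332 := g33 2
  simp only [graphEq, prodCoef, Matrix.cons_val, Fin.reduceEq, if_true, if_false, one_mul,
    sub_eq_zero, a1, a2, a3, a4, b1, b2, b3, b4] at g220 g221 g222 g230 g231 g232 g330 g331 g332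
  funext i
  obtain rfl | rfl | rfl := (by decide : ∀ i : Fin 3, i = 0 ∨ i = 1 ∨ i = 2) i
  · conv_lhs => rw [quadratic_expansion (hq.isHomogeneous 0)]
    simp only [lineQuadrics, Matrix.cons_val, *, C_add, C_mul, C_sub, C_0, C_1, map_ofNat]
    ring
  · conv_lhs => rw [quadratic_expansion (hq.isHomogeneous 1)]
    simp only [lineQuadrics, Matrix.cons_val, n4, n5, n6, g221, g231, g331, C_add, C_mul, C_sub,
      C_0, C_1]
    ring
  · conv_lhs => rw [quadratic_expansion (hq.isHomogeneous 2)]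
    simp only [lineQuadrics, Matrix.cons_val, *, C_add, C_mul, C_sub, C_0, C_1, map_ofNat]
    ring

end LineEquations

/-! ### The family of the nets attached to lines -/

universe v

/-- Clearing denominators: for a polynomial `g` and a fraction `u / d`, some `d ^ D * g (u / d)` is
the value of an element of the ring itself, compatibly with all ring homomorphisms that make `d`
invertible. -/
theorem exists_clear_denominators {K : Type v} [CommRing K] {ι : Type*} {S : Type*} [CommRing S]
    [Algebra K S] (u : ι → S) (d : S) (g : MvPolynomial ι K) :
    ∃ (D : ℕ) (h : S), ∀ {A : Type v} [CommRing A] [Algebra K A] (φ : S →ₐ[K] A) (r : A),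
      φ d * r = 1 → φ h = φ d ^ D * aeval (fun i => r * φ (u i)) g := by
  induction g using MvPolynomial.induction_on with
  | C c => exact ⟨0, algebraMap K S c, fun φ r _ => by simp⟩
  | add p q hp hq =>
    obtain ⟨D, h, hp⟩ := hp
    obtain ⟨E, k, hq⟩ := hq
    refine ⟨D + E, d ^ E * h + d ^ D * k, fun φ r hr => ?_⟩
    rw [map_add, map_mul, map_mul, map_pow, map_pow, hp φ r hr, hq φ r hr, map_add]
    ring
  | mul_X p i hp =>
    obtain ⟨D, h, hp⟩ := hp
    refine ⟨D + 1, h * u i, fun φ r hr => ?_⟩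
    rw [map_mul, hp φ r hr, map_mul, aeval_X, pow_succ]
    linear_combination -φ d ^ D * aeval (fun i => r * φ (u i)) p * φ (u i) * hr

section LineFamily

variable {K : Type v} [Field K] (b : Module.Basis (Fin 3 ⊕ Fin 7) K (Form K 2))
variable {A A' : Type*} [CommRing A] [Algebra K A] [CommRing A'] [Algebra K A']

/-- The family of the lines near `x₀ = x₁ = 0`: the generators of the square of the ideal of the
line `x₀ + p₀ x₂ + p₁ x₃ = x₁ + p₂ x₂ + p₃ x₃ = 0`. -/
def lineFamily (p : Fin 4 → A) : Fin 3 → MvPolynomial (Fin 4) A :=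
  lineQuadrics (X 0 + C (p 0) * X 2 + C (p 1) * X 3) (X 1 + C (p 2) * X 2 + C (p 3) * X 3)

theorem map_lineFamily (φ : A →+* A') (p : Fin 4 → A) (k : Fin 3) :
    map φ (lineFamily p k) = lineFamily (fun i => φ (p i)) k := by
  fin_cases k <;> simp [lineFamily, lineQuadrics]

theorem linear_isHomogeneous (i : Fin 4) (r s : A) :
    (X i + C r * X 2 + C s * X 3 : MvPolynomial (Fin 4) A).IsHomogeneous 1 :=
  ((isHomogeneous_X A i).add (isHomogeneous_C_mul_X r 2)).add (isHomogeneous_C_mul_X s 3)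

theorem lineFamily_isHomogeneous (p : Fin 4 → A) (k : Fin 3) :
    (lineFamily p k).IsHomogeneous 2 := by
  fin_cases k <;> exact (linear_isHomogeneous _ _ _).mul (linear_isHomogeneous _ _ _)

/-- The coordinates of the generators of the family with respect to the three distinguished
elements of `b`. -/
def lineMatrix (p : Fin 4 → A) : Matrix (Fin 3) (Fin 3) A :=
  Matrix.of fun k i => coord b (Sum.inl i) (lineFamily p k)

/-- The coordinates of the generators of the family with respect to the seven other elements of
`b`. -/
def lineMatrix' (p : Fin 4 → A) : Matrix (Fin 3) (Fin 7) A :=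
  Matrix.of fun k j => coord b (Sum.inr j) (lineFamily p k)

theorem lineMatrix_map (φ : A →ₐ[K] A') (p : Fin 4 → A) :
    lineMatrix b (fun i => φ (p i)) = (lineMatrix b p).map φ := by
  ext k i
  have := coord_map b φ (Sum.inl i) (lineFamily p k)
  rw [map_lineFamily] at this
  exact this

theorem lineMatrix'_map (φ : A →ₐ[K] A') (p : Fin 4 → A) :
    lineMatrix' b (fun i => φ (p i)) = (lineMatrix' b p).map φ := by
  ext k j
  have := coord_map b φ (Sum.inr j) (lineFamily p k)
  rw [map_lineFamily] at this
  exact this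

theorem gen_of_lineMatrix (p : Fin 4 → A) (M : Matrix (Fin 3) (Fin 3) A)
    (hM : M * lineMatrix b p = 1) (i : Fin 3) :
    gen b (fun ij => (M * lineMatrix' b p) ij.1 ij.2) i = ∑ k, M i k • lineFamily p k := by
  have h1 : ∀ l, ∑ k, M i k * lineMatrix b p k l = (1 : Matrix (Fin 3) (Fin 3) A) i l := fun l => by
    rw [← hM, Matrix.mul_apply]
  have h2 : ∀ k, lineFamily p k =
      ∑ l, lineMatrix b p k l • map (algebraMap K A) (b (Sum.inl l)).1 +
        ∑ j, lineMatrix' b p k j • map (algebraMap K A) (b (Sum.inr j)).1 := fun k =>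
    (sum_coord b (lineFamily_isHomogeneous p k)).trans (Fintype.sum_sum_type _)
  conv_rhs => simp only [h2]
  simp only [smul_add, Finset.sum_add_distrib, Finset.smul_sum, smul_smul]
  rw [Finset.sum_comm, Finset.sum_comm (f := fun k j => (M i k * lineMatrix' b p k j) • _)]
  simp only [← Finset.sum_smul, h1, Matrix.one_apply, ite_smul, one_smul, zero_smul,
    Finset.sum_ite_eq, Finset.mem_univ, if_true, gen, Matrix.mul_apply]

theorem lineMatrix_of_gen {a : Fin 3 × Fin 7 → A} {p : Fin 4 → A} {B : Matrix (Fin 3) (Fin 3) A}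
    (h : ∀ i, gen b a i = ∑ k, B i k • lineFamily p k) :
    B * lineMatrix b p = 1 ∧ ∀ ij, a ij = (B * lineMatrix' b p) ij.1 ij.2 := by
  constructor
  · ext i l
    have := congrArg (coord b (Sum.inl l)) (h i)
    rw [coord_inl_gen, map_sum] at this
    simp only [map_smul, smul_eq_mul] at this
    rw [Matrix.one_apply, this, Matrix.mul_apply]
    rfl
  · rintro ⟨i, j⟩
    have := congrArg (coord b (Sum.inr j)) (h i)
    rw [coord_inr_gen, map_sum] at this
    simp only [map_smul, smul_eq_mul] at this
    rw [this, Matrix.mul_apply]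
    rfl

theorem chartNet_mem_lineSquareNets {a : Fin 3 × Fin 7 → K} {p : Fin 4 → K}
    {B : Matrix (Fin 3) (Fin 3) K} (hB : IsUnit B.det)
    (h : ∀ i, gen b a i = ∑ k, B i k • lineFamily p k) :
    chartNet b a ∈ lineSquareNets K := by
  rw [mem_lineSquareNets_iff]
  refine ⟨_, _, linear_isHomogeneous 0 (p 0) (p 1), linear_isHomogeneous 1 (p 2) (p 3), ?_, ?_⟩
  · rw [LinearIndependent.pair_iff]
    intro x y hxy
    have h0 := congrArg (eval ![1, 0, 0, 0]) hxy
    have h1 := congrArg (eval ![0, 1, 0, 0]) hxy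
    simp at h0 h1
    exact ⟨h0, h1⟩
  · rw [map_chartNet]
    change _ = Submodule.span K (Set.range (lineFamily p))
    apply le_antisymm <;> rw [Submodule.span_le]
    · rintro _ ⟨i, rfl⟩
      rw [h]
      exact Submodule.sum_mem _ fun k _ => Submodule.smul_mem _ _ (Submodule.subset_span ⟨k, rfl⟩)
    · rintro _ ⟨k, rfl⟩
      have : lineFamily p k = ∑ i, B⁻¹ k i • gen b a i := by
        have h1 : ∀ l, ∑ i, B⁻¹ k i * B i l = (1 : Matrix (Fin 3) (Fin 3) K) k l := fun l => by
          rw [← Matrix.nonsing_inv_mul B hB, Matrix.mul_apply]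
        simp only [h, Finset.smul_sum, smul_smul]
        rw [Finset.sum_comm]
        simp only [← Finset.sum_smul, h1, Matrix.one_apply, ite_smul, one_smul, zero_smul,
          Finset.sum_ite_eq, Finset.mem_univ, if_true]
      rw [this]
      exact Submodule.sum_mem _ fun i _ => Submodule.smul_mem _ _ (Submodule.subset_span ⟨i, rfl⟩)

/-- A function that vanishes on all nets `(L)²` over the field `K` vanishes on every net of this
form over a `K`-algebra, reduced or not: the family of lines is parametrized by an affine space, on
which a polynomial is determined by its values. -/
theorem aeval_eq_zero_of_mem_chartIdeal [Infinite K] {A : Type v} [CommRing A] [Algebra K A]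
    {a : Fin 3 × Fin 7 → A} {p : Fin 4 → A} {B : Matrix (Fin 3) (Fin 3) A}
    (h : ∀ i, gen b a i = ∑ k, B i k • lineFamily p k) {g : MvPolynomial (Fin 3 × Fin 7) K}
    (hg : g ∈ chartIdeal b (lineSquareNets K)) : aeval a g = 0 := by
  let N := lineMatrix b (A := MvPolynomial (Fin 4) K) X
  let N' := lineMatrix' b (A := MvPolynomial (Fin 4) K) X
  obtain ⟨D, f, hf⟩ := exists_clear_denominators (fun ij => (N.adjugate * N') ij.1 ij.2) N.det g
  -- Base change of the universal matrices.
  have hN : ∀ {A : Type v} [CommRing A] [Algebra K A] (p : Fin 4 → A),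
      lineMatrix b p = N.map (aeval (R := K) p) ∧ lineMatrix' b p = N'.map (aeval (R := K) p) ∧
      aeval p N.det = (lineMatrix b p).det ∧ ∀ ij : Fin 3 × Fin 7,
        aeval p ((N.adjugate * N') ij.1 ij.2) =
          ((lineMatrix b p).adjugate * lineMatrix' b p) ij.1 ij.2 := by
    intro A _ _ p
    have e : (fun i => aeval p (X i : MvPolynomial (Fin 4) K)) = p := by funext i; simp
    have e1 := lineMatrix_map b (aeval p : MvPolynomial (Fin 4) K →ₐ[K] A) X
    have e2 := lineMatrix'_map b (aeval p : MvPolynomial (Fin 4) K →ₐ[K] A) X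
    rw [e] at e1 e2
    have e3 : (lineMatrix b p).adjugate = N.adjugate.map (aeval (R := K) p) := by
      rw [e1]; exact ((aeval (R := K) p).toRingHom.map_adjugate N).symm
    refine ⟨e1, e2, ?_, fun ij => ?_⟩
    · rw [AlgHom.map_det, e1]; rfl
    · rw [e3, e2, Matrix.mul_apply, Matrix.mul_apply, map_sum]
      exact Finset.sum_congr rfl fun k _ => map_mul _ _ _
  -- `f * N.det` vanishes at all points of the affine space, hence is zero.
  have hfd : f * N.det = 0 := by
    refine MvPolynomial.funext fun z => ?_
    rw [map_mul, map_zero]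
    by_cases hz : eval z N.det = 0
    · rw [hz, mul_zero]
    obtain ⟨-, -, e3, e4⟩ := hN z
    have hz' : (lineMatrix b z).det ≠ 0 := by rwa [← e3]
    have hfz := hf (aeval z) (lineMatrix b z).det⁻¹ (by rw [e3, mul_inv_cancel₀ hz'])
    have hinv : (lineMatrix b z)⁻¹ * lineMatrix b z = 1 :=
      Matrix.nonsing_inv_mul _ (isUnit_iff_ne_zero.2 hz')
    have hmem := chartNet_mem_lineSquareNets b (p := z) (B := (lineMatrix b z)⁻¹)
      (Matrix.isUnit_nonsing_inv_det _ (isUnit_iff_ne_zero.2 hz')) (gen_of_lineMatrix b z _ hinv)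
    have hgz := mem_vanishingIdeal_iff.1 hg _ hmem
    have ha : (fun ij : Fin 3 × Fin 7 => ((lineMatrix b z)⁻¹ * lineMatrix' b z) ij.1 ij.2) =
        fun ij => (lineMatrix b z).det⁻¹ * aeval z ((N.adjugate * N') ij.1 ij.2) := by
      funext ij
      rw [e4, Matrix.inv_def, Ring.inverse_eq_inv', Matrix.smul_mul, Matrix.smul_apply, smul_eq_mul]
    rw [ha] at hgz
    rw [hgz, mul_zero] at hfz
    rw [← coe_aeval_eq_eval]
    exact (congrArg (· * _) hfz).trans (zero_mul _)
  -- The point `p` over `A` is the specialization at which `N` becomes the inverse of `B`.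
  obtain ⟨-, -, e3, e4⟩ := hN p
  obtain ⟨hBN, ha⟩ := lineMatrix_of_gen b h
  have hdet : aeval p N.det * B.det = 1 := by
    rw [e3, mul_comm, ← Matrix.det_mul, hBN, Matrix.det_one]
  have hunit : IsUnit (aeval p N.det) := IsUnit.of_mul_eq_one _ hdet
  have hadj : B = B.det • (lineMatrix b p).adjugate := by
    have h1 : B * (lineMatrix b p * (lineMatrix b p).adjugate) = (lineMatrix b p).adjugate := by
      rw [← mul_assoc, hBN, one_mul]
    rw [Matrix.mul_adjugate, mul_smul_comm, mul_one] at h1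
    rw [← h1, smul_smul, mul_comm, ← e3, hdet, one_smul]
  have ha' : a = fun ij => B.det * aeval p ((N.adjugate * N') ij.1 ij.2) := by
    funext ij
    rw [ha, e4]
    nth_rw 1 [hadj]
    rw [Matrix.smul_mul, Matrix.smul_apply, smul_eq_mul]
  have hfp := hf (aeval p) B.det hdet
  have hf0 : aeval p f = 0 := by
    have := congrArg (aeval p) hfd
    rw [map_mul, map_zero] at this
    exact (hunit.mul_left_eq_zero).1 this
  rw [hf0, ← ha'] at hfp
  exact ((hunit.pow D).mul_right_eq_zero).1 hfp.symm

end LineFamily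

/-! ### The zero scheme contains the nets attached to lines, and the rank elsewhere -/

section ZeroScheme

section ZeroIdeal

variable {A : Type*} [CommRing A]

/-- Linear functions on forms are combinations of the coefficients. -/
theorem apply_mem_of_coeff_mem {d : ℕ} (f : Form A d →ₗ[A] A) {I : Ideal A} {w : Form A d}
    (hw : ∀ m, coeff m w.1 ∈ I) : f w ∈ I := by
  let pr : MvPolynomial (Fin 4) A →ₗ[A] Form A d :=
    (homogeneousComponent d).codRestrict (homogeneousSubmodule (Fin 4) A d)
      fun p => homogeneousComponent_isHomogeneous d p
  have hpr : pr w.1 = w := Subtype.ext (homogeneousComponent_eq_self w.2)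
  rw [← hpr, w.1.as_sum, map_sum, map_sum]
  refine Submodule.sum_mem _ fun m _ => ?_
  have : monomial m (coeff m w.1) = coeff m w.1 • monomial m (1 : A) := by
    rw [smul_monomial, smul_eq_mul, mul_one]
  rw [this, map_smul, map_smul, smul_eq_mul]
  exact I.mul_mem_right _ (hw m)

/-- The values of an alternating map on the span of `v` are multiples of its value at `v`. -/
theorem alternatingMap_apply_mem {M : Type*} [AddCommGroup M] [Module A M] {n : ℕ}
    (ψ : M [⋀^Fin n]→ₗ[A] A) {I : Ideal A} {v : Fin n → M} (hv : ψ v ∈ I) {x : Fin n → M}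
    (hx : ∀ i, x i ∈ Submodule.span A (Set.range v)) : ψ x ∈ I := by
  choose P hP using fun i => (Submodule.mem_span_range_iff_exists_fun A).1 (hx i)
  have hL : ∀ p, Fintype.linearCombination A v p = ∑ t, p t • v t := fun p => rfl
  have h1 : ψ x = (ψ.compLinearMap (Fintype.linearCombination A v)) P := by
    rw [AlternatingMap.compLinearMap_apply]
    exact congrArg ψ (funext fun i => ((hL _).trans (hP i)).symm)
  have h2 : (fun i => Fintype.linearCombination A v (Pi.basisFun A (Fin n) i)) = v := by
    funext i
    simp [hL, Pi.single_apply]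
  rw [h1, AlternatingMap.eq_smul_basis_det (Pi.basisFun A (Fin n)) (ψ.compLinearMap _),
    AlternatingMap.smul_apply, AlternatingMap.compLinearMap_apply, h2, smul_eq_mul]
  exact I.mul_mem_right _ hv

theorem zeroIdeal_map_le {M N : Type*} [AddCommGroup M] [Module A M] [AddCommGroup N] [Module A N]
    {n : ℕ} {φ : M →ₗ[A] N} {I : Ideal A}
    (h : ∀ (ψ : N [⋀^Fin n]→ₗ[A] A) (s : Fin n → M), ψ (φ ∘ s) ∈ I) :
    zeroIdeal (exteriorPower.map n φ) ≤ I := by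
  refine Ideal.span_le.2 ?_
  rintro _ ⟨m, f, rfl⟩
  have hm : m ∈ Submodule.span A (Set.range (exteriorPower.ιMulti A n (M := M))) := by
    rw [exteriorPower.ιMulti_span]; trivial
  induction hm using Submodule.span_induction with
  | mem x hx =>
    obtain ⟨s, rfl⟩ := hx
    rw [exteriorPower.map_apply_ιMulti]
    exact h (f.compAlternatingMap (exteriorPower.ιMulti A n)) s
  | zero => simp
  | add x y _ _ hx hy => rw [map_add, map_add]; exact add_mem hx hy
  | smul a x _ hx => rw [map_smul, map_smul]; exact I.mul_mem_left a hx

/-- If the generators of a module of quadratic forms satisfy the relation `q₀ q₂ = q₁²` modulo an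
ideal, then the sixth exterior power of the multiplication map vanishes modulo this ideal. -/
theorem zeroIdeal_le {I : Ideal A} {C : Submodule A (Form A 2)} {q : Fin 3 → Form A 2}
    (hC : C ≤ Submodule.span A (Set.range q))
    (hq : ∀ m, coeff m ((q 0).1 * (q 2).1 - (q 1).1 * (q 1).1) ∈ I) :
    zeroIdeal (exteriorPower.map 6 (mulMap C)) ≤ I := by
  let p : Fin 3 → MvPolynomial (Fin 4) A := fun i => (q i).1
  let v : Fin 6 → Form A 4 := fun t => ⟨products p t, (q (pair t).1).2.mul (q (pair t).2).2⟩
  refine zeroIdeal_map_le fun ψ s => alternatingMap_apply_mem ψ (v := v) ?_ fun i => ?_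
  · -- Modulo `I`, the alternating map is applied to a family with the repeated entry `v 2`.
    let w : Form A 4 := v 5 - v 2
    have hw : Function.update v 5 (v 2 + w) = v := by
      rw [add_sub_cancel, Function.update_eq_self]
    have h0 : ψ (Function.update v 5 (v 2)) = 0 :=
      ψ.map_eq_zero_of_eq _ (i := 5) (j := 2) (by simp) (by decide)
    rw [← hw, ψ.map_update_add, h0, zero_add]
    exact apply_mem_of_coeff_mem (ψ.toMultilinearMap.toLinearMap v 5) hq
  · have hle : C.map (homogeneousSubmodule (Fin 4) A 2).subtype ≤
        Submodule.span A (Set.range p) := by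
      refine (Submodule.map_mono hC).trans ?_
      rw [Submodule.map_span, ← Set.range_comp]
      exact le_rfl
    have h1 := mul_le_mul' hle hle (mulMap_mem C (s i))
    rw [span_mul_span_self] at h1
    obtain ⟨c, hc⟩ := (Submodule.mem_span_range_iff_exists_fun A).1 h1
    refine (Submodule.mem_span_range_iff_exists_fun A).2 ⟨c, Subtype.ext ?_⟩
    rw [Function.comp_apply, ← hc, Submodule.coe_sum]
    rfl

end ZeroIdeal

variable {K : Type*} [Field K]

theorem lineQuadrics_linearIndependent {h k : MvPolynomial (Fin 4) K} (hh : h.IsHomogeneous 1)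
    (hk : k.IsHomogeneous 1) (hli : LinearIndependent K ![h, k]) :
    LinearIndependent K (lineQuadrics h k) := by
  obtain ⟨e, e0, e1⟩ := exists_substHom_eq hh hk hli
  refine LinearIndependent.of_comp (substHom K e).toLinearMap ?_
  have : (substHom K e).toLinearMap ∘ lineQuadrics h k = lineQuadrics (X 0) (X 1) := by
    funext i; fin_cases i <;> simp [lineQuadrics, e0, e1]
  rw [this, Fintype.linearIndependent_iff]
  intro g hg
  have a0 := congrArg (eval ![1, 0, 0, 0]) hg
  have a1 := congrArg (eval ![0, 1, 0, 0]) hg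
  have a2 := congrArg (eval ![1, 1, 0, 0]) hg
  simp [lineQuadrics, Fin.sum_univ_three] at a0 a1 a2
  rw [a0, a1, zero_add, add_zero] at a2
  intro i
  fin_cases i
  exacts [a1, a2, a0]

theorem finrank_map_subtype {d : ℕ} (W : Submodule K (Form K d)) :
    Module.finrank K (W.map (homogeneousSubmodule (Fin 4) K d).subtype) = Module.finrank K W :=
  (LinearEquiv.finrank_eq (Submodule.equivMapOfInjective _ Subtype.val_injective W)).symm

/-- The square of the ideal of a line `h = k = 0` is generated by the minors of the matrix with rows
`(h, 0)`, `(k, h)`, `(0, k)`. -/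
theorem lineSquareNets_subset_detNets : lineSquareNets K ⊆ detNets K := by
  intro W hW
  obtain ⟨h, k, hh, hk, hli, hW⟩ := mem_lineSquareNets_iff.1 hW
  refine ⟨?_, !![⟨h, hh⟩, 0; ⟨k, hk⟩, ⟨h, hh⟩; 0, ⟨k, hk⟩], ?_⟩
  · rw [← finrank_map_subtype, hW,
      finrank_span_eq_card (lineQuadrics_linearIndependent hh hk hli), Fintype.card_fin]
  · rw [hW]
    congr 2
    funext i
    fin_cases i <;> simp [lineQuadrics, Matrix.det_fin_two, Fin.succAbove]

theorem finrank_range_mulMap [IsAlgClosed K] [CharZero K] {W : Submodule K (Form K 2)}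
    (hW : Module.finrank K W = 3) (hl : W ∉ lineSquareNets K) :
    Module.finrank K (LinearMap.range (mulMap W)) = 6 := by
  obtain ⟨w, hw, hwW⟩ := exists_linearIndependent_span_eq hW
  let p : Fin 3 → MvPolynomial (Fin 4) K := fun i => (w i).1
  have hp : LinearIndependent K p :=
    hw.map' (homogeneousSubmodule (Fin 4) K 2).subtype (Submodule.ker_subtype _)
  have hspan : W.map (homogeneousSubmodule (Fin 4) K 2).subtype =
      Submodule.span K (Set.range p) := by
    rw [← hwW, Submodule.map_span, ← Set.range_comp]
    rfl
  have hprod : LinearIndependent K (products p) := by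
    by_contra hd
    obtain ⟨h, k, hh, hk, hli, hs⟩ :=
      exists_line_of_dependent_products (fun i => (w i).2) hp hd
    exact hl (mem_lineSquareNets_iff.2 ⟨h, k, hh, hk, hli, hspan.trans hs⟩)
  have hrange : (LinearMap.range (mulMap W)).map (homogeneousSubmodule (Fin 4) K 4).subtype =
      Submodule.span K (Set.range (products p)) := by
    rw [← span_mul_span_self, ← hspan]
    apply le_antisymm
    · rintro _ ⟨_, ⟨s, rfl⟩, rfl⟩
      exact mulMap_mem W s
    · rw [Submodule.mul_le]
      rintro _ ⟨q, hq, rfl⟩ _ ⟨q', hq', rfl⟩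
      exact ⟨_, ⟨symMul W ⟨q, hq⟩ ⟨q', hq'⟩, rfl⟩, coe_mulMap_symMul W ⟨q, hq⟩ ⟨q', hq'⟩⟩
  rw [← finrank_map_subtype, hrange, finrank_span_eq_card hprod, Fintype.card_fin]

/-- A point `ev` at which the net is of the form `(L)²` belongs to the zero scheme of the sixth
exterior power of the multiplication map. -/
theorem zeroIdeal_mulMap_chartNet_le (b : Module.Basis (Fin 3 ⊕ Fin 7) K (Form K 2)) {A : Type*}
    [CommRing A] [Algebra K A] (ev : A →ₐ[K] K) (a : Fin 3 × Fin 7 → A)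
    {h k : MvPolynomial (Fin 4) K}
    (hW : Submodule.span K (Set.range (gen b fun ij => ev (a ij))) =
      Submodule.span K (Set.range (lineQuadrics h k))) :
    zeroIdeal (exteriorPower.map 6 (mulMap (chartNet b a))) ≤ RingHom.ker (ev : A →+* K) := by
  obtain ⟨T, T', hT, -, hg, hq⟩ := exists_inverse_matrices (gen_linearIndependent b _) hW
  let c : Fin 3 → Form A 2 := fun i => (b (Sum.inl i)).baseChange A +
    ∑ j : Fin 7, a (i, j) • (b (Sum.inr j)).baseChange A
  have hc : ∀ i, map (ev : A →+* K) (c i).1 = gen b (fun ij => ev (a ij)) i := by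
    intro i
    rw [← map_gen b ev, ← coe_chartNet_generator b a i]
  -- The constant change of generators that brings the fibre into the form `k², h k, h²`.
  let q : Fin 3 → Form A 2 := fun i => ∑ l, algebraMap K A (T' i l) • c l
  have hqz : ∀ i, map (ev : A →+* K) (q i).1 = lineQuadrics h k i := by
    intro i
    have hqi : (q i).1 = ∑ l, C (algebraMap K A (T' i l)) * (c l).1 := by
      simp only [q, Submodule.coe_sum, Submodule.coe_smul, smul_eq_C_mul]
    rw [hqi, map_sum, hq]
    refine Finset.sum_congr rfl fun l _ => ?_
    rw [map_mul, hc, map_C, smul_eq_C_mul]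
    exact congrArg (C · * _) (ev.commutes _)
  refine zeroIdeal_le (q := q) (Submodule.span_le.2 ?_) fun m => ?_
  · rintro _ ⟨i, rfl⟩
    have h1 : ∀ l, ∑ x, T i x * T' x l = (1 : Matrix (Fin 3) (Fin 3) K) i l := fun l => by
      rw [← hT, Matrix.mul_apply]
    have hci : c i = ∑ l, algebraMap K A (T i l) • q l := by
      simp only [q, Finset.smul_sum, smul_smul]
      rw [Finset.sum_comm]
      simp only [← Finset.sum_smul, ← map_mul, ← map_sum, h1, Matrix.one_apply]
      simp [apply_ite]
    change c i ∈ _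
    rw [hci]
    exact Submodule.sum_mem _ fun l _ => Submodule.smul_mem _ _ (Submodule.subset_span ⟨l, rfl⟩)
  · rw [RingHom.mem_ker, ← coeff_map]
    have h0 : map (ev : A →+* K) ((q 0).1 * (q 2).1 - (q 1).1 * (q 1).1) = 0 := by
      rw [map_sub, map_mul, map_mul, hqz, hqz, hqz]
      simp only [lineQuadrics, Matrix.cons_val]
      ring
    rw [h0, coeff_zero]

/-- The exterior power of the multiplication map vanishes at the nets `(L)²`. -/
theorem zeroSchemeIdeal_le_chartIdeal (b : Module.Basis (Fin 3 ⊕ Fin 7) K (Form K 2)) :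
    zeroSchemeIdeal b ≤ chartIdeal b (lineSquareNets K) := by
  intro r hr
  refine mem_vanishingIdeal_iff.2 fun z hz => ?_
  have hz' : chartNet b z ∈ detNets K := lineSquareNets_subset_detNets hz
  let ev : CoordRing b →ₐ[K] K := Ideal.Quotient.liftₐ (chartIdeal b (detNets K)) (aeval z)
    fun s hs => mem_vanishingIdeal_iff.1 hs z hz'
  have hev : ∀ s, ev (Ideal.Quotient.mk _ s) = aeval z s := fun s => rfl
  obtain ⟨h, k, -, -, -, hW⟩ := mem_lineSquareNets_iff.1 hz
  rw [map_chartNet] at hW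
  have hle := zeroIdeal_mulMap_chartNet_le b ev
    (fun ij => Ideal.Quotient.mk (chartIdeal b (detNets K)) (X ij)) (h := h) (k := k)
    (by simp only [hev, aeval_X]; exact hW)
  exact hle hr

end ZeroScheme

/-! ### Normalization of a net, and the local comparison of the ideals -/

section Local

section Normalization

variable {A A' : Type*} [CommRing A] [CommRing A']

theorem pureCoef_sum {n : ℕ} (r : Fin n → A) (p : Fin n → MvPolynomial (Fin 4) A) (k : Fin 3) :
    pureCoef (∑ i, r i • p i) k = ∑ i, r i * pureCoef (p i) k := by
  fin_cases k <;> simp [pureCoef]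

theorem pureCoef_map (f : A →+* A') (p : MvPolynomial (Fin 4) A) (k : Fin 3) :
    pureCoef (map f p) k = f (pureCoef p k) := by
  fin_cases k <;> simp [pureCoef, coef_map]

theorem pureCoef_lineQuadrics (k : Fin 3) :
    pureCoef (lineQuadrics (X 0) (X 1) k : MvPolynomial (Fin 4) A) = Pi.single k 1 := by
  funext l
  fin_cases k <;> fin_cases l <;> simp [pureCoef, lineQuadrics, coef]

theorem graphEq_map (f : A →+* A') (δ : A) (q : Fin 3 → MvPolynomial (Fin 4) A) (j l : Fin 4)
    (i : Fin 3) : graphEq (f δ) (fun k => map f (q k)) j l i = f (graphEq δ q j l i) := by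
  fin_cases i <;> by_cases h : j = l <;> simp [graphEq, prodCoef, coef_map, h]

theorem graphEq_smul (δ : A) (q : Fin 3 → MvPolynomial (Fin 4) A) (j l : Fin 4) (i : Fin 3) :
    graphEq δ (fun k => δ • q k) j l i = δ ^ 2 * graphEq 1 q j l i := by
  fin_cases i <;> by_cases h : j = l <;> simp [graphEq, prodCoef, h] <;> ring

end Normalization

variable {K : Type v} [Field K] (b : Module.Basis (Fin 3 ⊕ Fin 7) K (Form K 2))

section Adjugate

variable {A A' : Type*} [CommRing A] [Algebra K A] [CommRing A'] [Algebra K A']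

/-- The coefficients of `x₁²`, `x₀ x₁`, `x₀²` in the generators of a net. Its determinant cuts out
the complement of the chart of the Grassmannian around `(x₀, x₁)²`. -/
def pureMatrix (a : Fin 3 × Fin 7 → A) : Matrix (Fin 3) (Fin 3) A :=
  Matrix.of fun i => pureCoef (gen b a i)

/-- The normalized generators of a net, multiplied by the determinant of `pureMatrix`. -/
def adjGen (a : Fin 3 × Fin 7 → A) (i : Fin 3) : MvPolynomial (Fin 4) A :=
  ∑ k, (pureMatrix b a).adjugate i k • gen b a k

theorem pureMatrix_map (φ : A →ₐ[K] A') (a : Fin 3 × Fin 7 → A) :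
    pureMatrix b (fun ij => φ (a ij)) = (pureMatrix b a).map φ := by
  ext i k
  have := pureCoef_map (φ : A →+* A') (gen b a i) k
  rw [map_gen] at this
  exact this

theorem det_pureMatrix_map (φ : A →ₐ[K] A') (a : Fin 3 × Fin 7 → A) :
    (pureMatrix b fun ij => φ (a ij)).det = φ (pureMatrix b a).det := by
  rw [AlgHom.map_det, pureMatrix_map]
  rfl

theorem map_adjGen (φ : A →ₐ[K] A') (a : Fin 3 × Fin 7 → A) (i : Fin 3) :
    map (φ : A →+* A') (adjGen b a i) = adjGen b (fun ij => φ (a ij)) i := by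
  have h1 : (pureMatrix b fun ij => φ (a ij)).adjugate = (pureMatrix b a).adjugate.map φ := by
    rw [pureMatrix_map]; exact (φ.toRingHom.map_adjugate (pureMatrix b a)).symm
  simp only [adjGen, h1, smul_eq_C_mul, map_sum, map_mul, map_C, map_gen]
  rfl

theorem adjGen_isNormalized (a : Fin 3 × Fin 7 → A) :
    IsNormalized (pureMatrix b a).det (adjGen b a) where
  isHomogeneous i := (mem_homogeneousSubmodule _ _).1 (Submodule.sum_mem _ fun k _ =>
    Submodule.smul_mem _ _ ((mem_homogeneousSubmodule _ _).2 (gen_isHomogeneous b a k)))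
  pureCoef_eq i := by
    funext k
    have : pureCoef (adjGen b a i) k = ((pureMatrix b a).adjugate * pureMatrix b a) i k := by
      rw [adjGen, pureCoef_sum, Matrix.mul_apply]; rfl
    rw [this, Matrix.adjugate_mul, Matrix.smul_apply, Matrix.one_apply, smul_eq_mul,
      Pi.single_apply]
    simp [eq_comm]

theorem sum_pureMatrix_smul_adjGen (a : Fin 3 × Fin 7 → A) (i : Fin 3) :
    ∑ k, pureMatrix b a i k • adjGen b a k = (pureMatrix b a).det • gen b a i := by
  have h1 : ∀ l, ∑ k, pureMatrix b a i k * (pureMatrix b a).adjugate k l =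
      ((pureMatrix b a).det • (1 : Matrix (Fin 3) (Fin 3) A)) i l := fun l => by
    rw [← Matrix.mul_adjugate, Matrix.mul_apply]
  simp only [adjGen, Finset.smul_sum, smul_smul]
  rw [Finset.sum_comm]
  simp only [← Finset.sum_smul, h1, Matrix.smul_apply, Matrix.one_apply, smul_eq_mul, mul_ite,
    mul_one, mul_zero, ite_smul, zero_smul, Finset.sum_ite_eq, Finset.mem_univ, if_true]

theorem span_adjGen {a : Fin 3 × Fin 7 → A} {r : A} (hr : r * (pureMatrix b a).det = 1) :
    Submodule.span A (Set.range (adjGen b a)) = Submodule.span A (Set.range (gen b a)) := by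
  apply le_antisymm <;> rw [Submodule.span_le]
  · rintro _ ⟨i, rfl⟩
    exact Submodule.sum_mem _ fun k _ => Submodule.smul_mem _ _ (Submodule.subset_span ⟨k, rfl⟩)
  · rintro _ ⟨i, rfl⟩
    have : gen b a i = r • ∑ k, pureMatrix b a i k • adjGen b a k := by
      rw [sum_pureMatrix_smul_adjGen, smul_smul, hr, one_smul]
    rw [this]
    exact Submodule.smul_mem _ _ (Submodule.sum_mem _ fun k _ =>
      Submodule.smul_mem _ _ (Submodule.subset_span ⟨k, rfl⟩))

end Adjugate

/-- The equations of the graph, for the generators normalized with the help of the adjugate, vanish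
on the determinantal nets of the chart of `b`. The factor in front takes care of the nets outside
the chart around `(x₀, x₁)²`, which need not satisfy the equations. -/
theorem graphEq_adjGen_mem [CharZero K] {j l : Fin 4}
    (hjl : (j, l) ∈ ({(2, 2), (2, 3), (3, 3)} : Set (Fin 4 × Fin 4))) (i : Fin 3) :
    (pureMatrix b (univCoord (K := K))).det *
        graphEq (pureMatrix b univCoord).det (adjGen b univCoord) j l i ∈
      chartIdeal b (detNets K) := by
  refine mem_vanishingIdeal_iff.2 fun z hz => ?_
  have hz0 : (fun ij => aeval z (univCoord ij : MvPolynomial (Fin 3 × Fin 7) K)) = z := by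
    funext ij; simp
  have h1 := det_pureMatrix_map b (aeval z : MvPolynomial (Fin 3 × Fin 7) K →ₐ[K] K) univCoord
  have h2 := fun k => map_adjGen b (aeval z : MvPolynomial (Fin 3 × Fin 7) K →ₐ[K] K) univCoord k
  have h3 := graphEq_map ((aeval z : MvPolynomial (Fin 3 × Fin 7) K →ₐ[K] K) :
    MvPolynomial (Fin 3 × Fin 7) K →+* K)
    (pureMatrix b (univCoord (K := K))).det (adjGen b univCoord) j l i
  simp only [h2, hz0] at h3
  rw [hz0] at h1
  have h4 : aeval z (graphEq (pureMatrix b (univCoord (K := K))).det (adjGen b univCoord) j l i) =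
      graphEq (pureMatrix b z).det (adjGen b z) j l i := by rw [h1]; exact h3.symm
  rw [map_mul, ← h1, h4]
  by_cases hδ : (pureMatrix b z).det = 0
  · rw [hδ, zero_mul]
  obtain ⟨-, u, hu⟩ := hz
  have hspan := span_adjGen b (a := z) (inv_mul_cancel₀ hδ)
  have hli : LinearIndependent K (adjGen b z) :=
    linearIndependent_of_mem_span (gen_linearIndependent b z) fun i =>
      hspan ▸ Submodule.subset_span ⟨i, rfl⟩
  rw [map_chartNet, ← hspan] at hu
  rw [(adjGen_isNormalized b z).graphEq_eq_zero hδ hli hu hjl i, mul_zero]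

/-- Over a `K`-algebra in which the equations of the determinantal nets and the minors vanish, and
in which the net lies in the chart around `(x₀, x₁)²`, all the equations of the variety of the nets
`(L)²` vanish. -/
theorem apply_eq_zero_of_isUnit_det [CharZero K] {A : Type v} [CommRing A] [Algebra K A]
    (φ : MvPolynomial (Fin 3 × Fin 7) K →ₐ[K] A)
    (hX : ∀ r ∈ chartIdeal b (detNets K), φ r = 0)
    (hV : MinorsVanish (Submodule.span A (Set.range (gen b fun ij => φ (X ij)))))
    (hδ : IsUnit (φ (pureMatrix b univCoord).det)) {g : MvPolynomial (Fin 3 × Fin 7) K}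
    (hg : g ∈ chartIdeal b (lineSquareNets K)) : φ g = 0 := by
  have h1 := det_pureMatrix_map b φ univCoord
  have h2 := fun k => map_adjGen b φ univCoord k
  set a : Fin 3 × Fin 7 → A := fun ij => φ (X ij)
  obtain ⟨r, hr⟩ := hδ.exists_left_inv
  rw [← h1] at hr hδ
  set δ := (pureMatrix b a).det
  have hn := adjGen_isNormalized b a
  let q : Fin 3 → MvPolynomial (Fin 4) A := fun i => r • adjGen b a i
  have hadj : adjGen b a = fun i => δ • q i := by
    funext i
    rw [smul_smul, mul_comm, hr, one_smul]
  have hq : IsNormalized 1 q := by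
    refine ⟨fun i => (mem_homogeneousSubmodule _ _).1 (Submodule.smul_mem _ _
      ((mem_homogeneousSubmodule _ _).2 (hn.isHomogeneous i))), fun i => funext fun k => ?_⟩
    have h3 := pureCoef_sum (fun _ : Fin 1 => r) (fun _ => adjGen b a i) k
    rw [Fin.sum_univ_one, Fin.sum_univ_one, hn.pureCoef_eq, Pi.single_apply, mul_ite, mul_zero,
      hr] at h3
    rw [h3, Pi.single_apply]
  have hgen : ∀ i, gen b a i = ∑ k, pureMatrix b a i k • q k := by
    intro i
    have h3 : r • ∑ k, pureMatrix b a i k • adjGen b a k = r • δ • gen b a i :=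
      congrArg (r • ·) (sum_pureMatrix_smul_adjGen b a i)
    rw [smul_smul, hr, one_smul, Finset.smul_sum] at h3
    rw [← h3]
    exact Finset.sum_congr rfl fun k _ => smul_comm _ _ _
  have hspan : Submodule.span A (Set.range q) = Submodule.span A (Set.range (gen b a)) := by
    rw [← span_adjGen b hr]
    apply le_antisymm <;> rw [Submodule.span_le]
    · rintro _ ⟨i, rfl⟩
      exact Submodule.smul_mem _ _ (Submodule.subset_span ⟨i, rfl⟩)
    · rintro _ ⟨i, rfl⟩
      rw [hadj]
      exact Submodule.smul_mem _ _ (Submodule.subset_span ⟨i, rfl⟩)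
  have hG : ∀ jl ∈ ({(2, 2), (2, 3), (3, 3)} : Set (Fin 4 × Fin 4)), ∀ i,
      graphEq 1 q jl.1 jl.2 i = 0 := by
    rintro ⟨j, l⟩ hjl i
    have h3 := hX _ (graphEq_adjGen_mem b hjl i)
    rw [map_mul, ← h1] at h3
    have h4 := graphEq_map (φ : MvPolynomial (Fin 3 × Fin 7) K →+* A)
      (pureMatrix b univCoord).det (adjGen b univCoord) j l i
    simp only [h2] at h4
    have h5 : φ (graphEq (pureMatrix b univCoord).det (adjGen b univCoord) j l i) =
        δ ^ 2 * graphEq 1 q j l i := by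
      rw [← graphEq_smul, ← hadj]
      refine h4.symm.trans ?_
      exact congrArg (fun x => graphEq x (adjGen b a) j l i) h1.symm
    rw [h5] at h3
    exact ((hδ.pow 2).mul_right_eq_zero).1 ((hδ.mul_right_eq_zero).1 h3)
  have hline := hq.eq_lineQuadrics (by rwa [hspan]) hG
  have := aeval_eq_zero_of_mem_chartIdeal b (a := a) (B := pureMatrix b a)
    (p := ![coef 1 2 (q 1), coef 1 3 (q 1), coef 0 2 (q 1), coef 0 3 (q 1)])
    (fun i => (hgen i).trans (Finset.sum_congr rfl fun k _ => congrArg _ (congrFun hline k))) hg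
  rw [← this]
  exact DFunLike.congr_fun (aeval_unique φ) g

/-- A point where all the minors vanish is a net `(L)²`. -/
theorem exists_line_of_minorsVanish [IsAlgClosed K] [CharZero K] {z : Fin 3 × Fin 7 → K}
    (hV : MinorsVanish (Submodule.span K (Set.range (gen b z)))) :
    ∃ h k : MvPolynomial (Fin 4) K, h.IsHomogeneous 1 ∧ k.IsHomogeneous 1 ∧
      LinearIndependent K ![h, k] ∧
      Submodule.span K (Set.range (gen b z)) = Submodule.span K (Set.range (lineQuadrics h k)) := by
  refine exists_line_of_dependent_products (gen_isHomogeneous b z) (gen_linearIndependent b z)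
    fun hli => ?_
  -- If the products were independent, the minor with respect to dual functions would be one.
  choose g hg using fun i => LinearMap.exists_extend (Finsupp.lapply i ∘ₗ hli.repr)
  have hdet := hV (products (gen b z)) (fun j => by
    rw [span_mul_span_self]; exact Submodule.subset_span ⟨j, rfl⟩) g
  have h1 : (Matrix.of fun j i => g i (products (gen b z) j)) = 1 := by
    ext j i
    have := LinearMap.congr_fun (hg i)
      ⟨products (gen b z) j, Submodule.subset_span ⟨j, rfl⟩⟩
    simp only [LinearMap.comp_apply, Submodule.subtype_apply] at this
    rw [Matrix.of_apply, this, hli.repr_eq_single j _ rfl,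
      Finsupp.lapply_apply, Finsupp.single_apply, Matrix.one_apply]
  rw [h1, Matrix.det_one] at hdet
  exact one_ne_zero hdet

/-- The equations of the variety of the nets `(L)²` belong to the ideal of the zero scheme. This is
checked locally on the chart, in the neighbourhood `δ ≠ 0` of a point `z` of the zero scheme, which
is moved to the net `(x₀, x₁)²`. -/
theorem chartIdeal_le_zeroSchemeIdeal_of_lines [IsAlgClosed K] [CharZero K] :
    chartIdeal b (lineSquareNets K) ≤ zeroSchemeIdeal b := by
  intro g hg
  by_contra hgJ
  set J := zeroSchemeIdeal b with hJ
  -- The maximal ideal of a point `z` at which `g` does not belong to `J` locally.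
  obtain ⟨M, hM, hle⟩ := Ideal.exists_le_maximal (J.colon {g}) (by
    rw [Ne, Ideal.eq_top_iff_one]
    intro h
    rw [Submodule.mem_colon_singleton, one_smul] at h
    exact hgJ h)
  obtain ⟨z, rfl⟩ := isMaximal_iff_eq_vanishingIdeal_singleton.1 hM
  have hz : ∀ r, r * g ∈ J → aeval z r = 0 := fun r hr =>
    (mem_vanishingIdeal_singleton_iff z r).1 (hle (Submodule.mem_colon_singleton.2 hr))
  have hVz := minorsVanish_of_kills b (aeval z : MvPolynomial (Fin 3 × Fin 7) K →ₐ[K] K)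
    fun r hr => hz r (J.mul_mem_right g hr)
  simp only [aeval_X] at hVz
  obtain ⟨h, k, hh, hk, hli, hspan⟩ := exists_line_of_minorsVanish b hVz
  obtain ⟨e, e0, e1⟩ := exists_substHom_eq hh hk hli
  let b' := b.map (substForm 2 e)
  let δ := (pureMatrix b' (univCoord (K := K))).det
  -- The net at `z` is moved to `(x₀, x₁)²`, where `δ` does not vanish.
  have hδz : aeval z δ ≠ 0 := by
    have h1 := det_pureMatrix_map b' (aeval z : MvPolynomial (Fin 3 × Fin 7) K →ₐ[K] K) univCoord
    simp only [aeval_X] at h1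
    rw [← h1]
    obtain ⟨T, T', hT, -, hgen, -⟩ := exists_inverse_matrices (gen_linearIndependent b z) hspan
    have hT' : pureMatrix b' z = T := by
      ext i l
      have hgi : gen b' z i = ∑ m, T i m • lineQuadrics (X 0) (X 1) m := by
        rw [gen_map_substForm, hgen, map_sum]
        refine Finset.sum_congr rfl fun m _ => ?_
        rw [map_smul]
        congr 1
        fin_cases m <;> simp [lineQuadrics, e0, e1]
      rw [pureMatrix, Matrix.of_apply, hgi, pureCoef_sum]
      simp [pureCoef_lineQuadrics, Pi.single_apply]
    rw [hT']
    intro h0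
    have := congrArg Matrix.det hT
    rw [Matrix.det_mul, h0, zero_mul, Matrix.det_one] at this
    exact zero_ne_one this
  let E := Localization.Away (Ideal.Quotient.mk J δ)
  let φ : MvPolynomial (Fin 3 × Fin 7) K →ₐ[K] E :=
    (IsScalarTower.toAlgHom K (MvPolynomial (Fin 3 × Fin 7) K ⧸ J) E).comp (Ideal.Quotient.mkₐ K J)
  have hφ : ∀ r, φ r = algebraMap (MvPolynomial (Fin 3 × Fin 7) K ⧸ J) E (Ideal.Quotient.mk J r) :=
    fun r => rfl
  have hφJ : ∀ r ∈ J, φ r = 0 := fun r hr => by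
    rw [hφ, Ideal.Quotient.eq_zero_iff_mem.2 hr, map_zero]
  have hVE := (minorsVanish_of_kills b φ hφJ).map (substHom E e)
  have hmap : (Submodule.span E (Set.range (gen b fun ij => φ (X ij)))).map
      (substHom E e).toLinearMap = Submodule.span E (Set.range (gen b' fun ij => φ (X ij))) := by
    rw [Submodule.map_span, ← Set.range_comp]
    congr 2
    funext i
    exact (gen_map_substForm b e _ i).symm
  rw [hmap] at hVE
  have hφg : φ g = 0 := by
    refine apply_eq_zero_of_isUnit_det b' φ (fun r hr => ?_) hVE ?_ ?_
    · rw [chartIdeal_map_substForm b e map_substForm_mem_detNets] at hr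
      exact hφJ r (chartIdeal_le_zeroSchemeIdeal b hr)
    · exact IsLocalization.Away.algebraMap_isUnit (S := E) (Ideal.Quotient.mk J δ)
    · rwa [chartIdeal_map_substForm b e map_substForm_mem_lineSquareNets]
  rw [hφ, IsLocalization.map_eq_zero_iff (Submonoid.powers (Ideal.Quotient.mk J δ))] at hφg
  obtain ⟨⟨_, n, rfl⟩, hn⟩ := hφg
  have hn' : δ ^ n * g ∈ J := by
    rw [← Ideal.Quotient.eq_zero_iff_mem, map_mul, map_pow]
    exact hn
  have := hz _ hn'
  rw [map_pow] at this
  exact hδz (eq_zero_of_pow_eq_zero this)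

end Local

end DetNets

end

theorem mainTheorem5 (K : Type*) [Field K] [IsAlgClosed K] [CharZero K] :
    DetNets.lineSquareNets K ⊆ DetNets.detNets K ∧
    (∀ W ∈ DetNets.detNets K, W ∉ DetNets.lineSquareNets K →
      Module.finrank K (LinearMap.range (DetNets.mulMap W)) = 6) ∧
    (∀ b : Module.Basis (Fin 3 ⊕ Fin 7) K (DetNets.Form K 2),
      DetNets.zeroSchemeIdeal b = DetNets.chartIdeal b (DetNets.lineSquareNets K)) :=
  ⟨DetNets.lineSquareNets_subset_detNets,
    fun _ hW hl => DetNets.finrank_range_mulMap hW.1 hl,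
    fun b => le_antisymm (DetNets.zeroSchemeIdeal_le_chartIdeal b)
      (DetNets.chartIdeal_le_zeroSchemeIdeal_of_lines b)⟩
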